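/- Let $r>0$, $q=e^{-\pi\sqrt r}$, $K(x)=\frac{\pi}{2}\,{}_2F_1\left(\frac12,\frac12;1;x^2\right)$, and let $k_r\in(0,1)$ be the singular modulus, i.e. the solution of $K\left(\sqrt{1-k_r^2}\right)/K(k_r)=\sqrt r$. Write $K=K(k_r)$ and $K'=K\left(\sqrt{1-k_r^2}\right)$. Let $\mathrm{cd}(q,u)=\mathrm{cn}(q,u)/\mathrm{dn}(q,u)$ be the Jacobi elliptic function of modulus $k_r$ (and nome $q$). The series $$\mathrm{cd}_1(q,u)=\frac{2\pi}{Kk_r}\sum_{n=0}^{\infty}\frac{(-1)^nq^{n+1/2}\cos\left((2n+3)\frac{\pi u}{2K}\right)}{1-q^{2n+1}}$$ converges for $|\mathrm{Im}\,u|<K'$, and its sum has a meromorphic continuation to $\mathbf{C}$, which is again denoted by $\mathrm{cd}_1(q,u)$. If $u\in\mathbf{C}$ satisfies $\left|q^{1/2}e^{i\pi u/(2K)}\right|<1$, $\sin(\pi u/K)\neq0$, and $u$ is not a pole of $\mathrm{cd}(q,\cdot)$, then for $A=iq^{1/2}e^{i\pi u/(2K)}$ the series on the left below converges absolutely and $$\frac{2\pi}{Kk_r}\sum_{n=0}^{\infty}\frac{A^{2n+1}}{1-q^{2n+1}}=-\mathrm{cd}(q,u)\cot\left(\frac{\pi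 u}{K}\right)+\mathrm{cd}_1(q,u)\csc\left(\frac{\pi u}{K}\right)+i\,\mathrm{cd}(q,u).$$ -/

import Mathlib

noncomputable section

/-- The complete elliptic integral of the first kind as a function of the modulus `x`,
`K(x) = (π / 2) * ₂F₁(1/2, 1/2; 1; x ^ 2)`. -/
def ellipticK (x : ℝ) : ℝ :=
  Real.pi / 2 * ordinaryHypergeometric (1 / 2 : ℝ) (1 / 2 : ℝ) (1 : ℝ) (x ^ 2)

/-- `k` is the singular modulus `k_r`: the solution in `(0, 1)` of `K(√(1 - k ^ 2)) / K(k) = √r`. -/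
structure IsSingularModulus (r k : ℝ) : Prop where
  pos : 0 < k
  lt_one : k < 1
  ratio : ellipticK (Real.sqrt (1 - k ^ 2)) / ellipticK k = Real.sqrt r

/-- The nome `q = exp (-π √r)`. -/
def nome (r : ℝ) : ℝ := Real.exp (-Real.pi * Real.sqrt r)

/-- The parameter `τ = i √r`, so that `q = exp (π i τ)`. -/
def nomeTau (r : ℝ) : ℂ := Complex.I * (Real.sqrt r : ℂ)

/-- The Jacobi theta function `ϑ₃(z, q) = ∑_{n ∈ ℤ} q ^ (n ^ 2) e ^ (2 n i z)`. -/
def theta3 (r : ℝ) (z : ℂ) : ℂ := jacobiTheta₂ (z / Real.pi) (nomeTau r)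

/-- The Jacobi theta function `ϑ₂(z, q) = ∑_{n ∈ ℤ} q ^ ((n + 1/2) ^ 2) e ^ ((2 n + 1) i z)`,
that is `q ^ (1/4) e ^ (i z) ϑ₃(z + π τ / 2, q)`. -/
def theta2 (r : ℝ) (z : ℂ) : ℂ :=
  Complex.exp (Real.pi * Complex.I * nomeTau r / 4 + Complex.I * z) *
    jacobiTheta₂ (z / Real.pi + nomeTau r / 2) (nomeTau r)

lemma theta3_eq_tsum (r : ℝ) (z : ℂ) :
    theta3 r z = ∑' n : ℤ, (nome r : ℂ) ^ (n ^ 2) * Complex.exp (2 * n * Complex.I * z) := by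
  unfold theta3 jacobiTheta₂
  refine tsum_congr fun n => ?_
  have hpi : (Real.pi : ℂ) ≠ 0 := by exact_mod_cast Real.pi_ne_zero
  rw [jacobiTheta₂_term, nome, Complex.ofReal_exp, ← Complex.exp_int_mul, ← Complex.exp_add]
  congr 1
  unfold nomeTau
  push_cast
  field_simp
  linear_combination (n : ℂ) ^ 2 * Real.pi * (Real.sqrt r) * Complex.I_sq

lemma theta2_eq_tsum (r : ℝ) (z : ℂ) :
    theta2 r z = ∑' n : ℤ, ((nome r ^ (((n : ℝ) + 1 / 2) ^ 2) : ℝ) : ℂ) *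
      Complex.exp ((2 * n + 1) * Complex.I * z) := by
  unfold theta2 jacobiTheta₂
  rw [← tsum_mul_left]
  refine tsum_congr fun n => ?_
  have hpi : (Real.pi : ℂ) ≠ 0 := by exact_mod_cast Real.pi_ne_zero
  rw [jacobiTheta₂_term, nome, ← Real.exp_mul, Complex.ofReal_exp, ← Complex.exp_add,
    ← Complex.exp_add]
  congr 1
  unfold nomeTau
  push_cast
  field_simp
  linear_combination (16 * (n : ℂ) ^ 2 + 16 * n + 4) * Real.pi * (Real.sqrt r) * Complex.I_sq

/-- The theta-function variable `z = π u / (2 K)` that belongs to the argument `u`. -/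
def thetaArg (k : ℝ) (u : ℂ) : ℂ := Real.pi * u / (2 * ellipticK k)

/-- The Jacobi elliptic function `cd(q, u) = cn(q, u) / dn(q, u)` of modulus `k = k_r` and nome
`q = exp (-π √r)`. From `cn = (ϑ₄(0) / ϑ₂(0)) (ϑ₂(z) / ϑ₄(z))` and
`dn = (ϑ₄(0) / ϑ₃(0)) (ϑ₃(z) / ϑ₄(z))`, with `z = π u / (2 K)`, it is the quotient below, in which
the common poles of `cn` and `dn` have been cancelled. Its poles are the zeros of `ϑ₃(z)`. -/
def jacobiCd (r k : ℝ) (u : ℂ) : ℂ :=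
  (theta3 r 0 / theta2 r 0) * (theta2 r (thetaArg k u) / theta3 r (thetaArg k u))

/-- The `n`-th term of the Fourier-type series of `cd₁(q, u)`,
`(2 π / (K k)) (-1) ^ n q ^ (n + 1/2) cos ((2 n + 3) π u / (2 K)) / (1 - q ^ (2 n + 1))`. -/
def cdOneTerm (r k : ℝ) (u : ℂ) (n : ℕ) : ℂ :=
  (2 * Real.pi / (ellipticK k * k)) *
    ((-1) ^ n * ((nome r ^ ((n : ℝ) + 1 / 2) : ℝ) : ℂ) *
      Complex.cos ((2 * n + 3) * (Real.pi / (2 * ellipticK k)) * u) /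
        (1 - (nome r : ℂ) ^ (2 * n + 1)))

/-- `F` is the function `cd₁(q, ·)`: it is the sum of its series on the strip `|Im u| < K'` on which
the series converges, and it is the meromorphic continuation of this sum to the whole plane. By the
identity theorem there is at most one such `F` (the normal form fixes the values at isolated points:
the limit where it is finite, and the value `0` at a pole). -/
structure IsCdOne (r k : ℝ) (F : ℂ → ℂ) : Prop where
  meromorphic : MeromorphicNFOn F Set.univ
  hasSum : ∀ u : ℂ, |u.im| < ellipticK (Real.sqrt (1 - k ^ 2)) → HasSum (cdOneTerm r k u) (F u)

/-- The function `cd₁(q, u)`: the unique function with the property `IsCdOne`. -/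
def cdOne (r k : ℝ) : ℂ → ℂ := Classical.epsilon (IsCdOne r k)

/-- `q ^ (1/2) e ^ (i π u / (2 K))`. -/
def halfNomeExp (r k : ℝ) (u : ℂ) : ℂ :=
  ((nome r ^ (1 / 2 : ℝ) : ℝ) : ℂ) * Complex.exp (Complex.I * Real.pi * u / (2 * ellipticK k))

end

/-! Put `z = π u / (2 K)`, `w = e^{iz}`, `c = 2π / (K k)` and `L(x) = ∑ (-1)^n x^(2n+1) / (1 -
q^(2n+1))`. In the strip `|Im u| < K'`, away from the zeros of `ϑ₃(z)`, the Fourier series are `cd =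
(c/2) (L(q^(1/2) w) + L(q^(1/2) / w))` and `cd₁ = (c/2) (w² L(q^(1/2) w) + w⁻² L(q^(1/2) / w))`.
Eliminating `L(q^(1/2) / w)` gives `cd₁ = w⁻² cd + (c/2) (w² - w⁻²) L(q^(1/2) w)`. The right side is
meromorphic on the half-plane `|q^(1/2) w| < 1`, so by the identity theorem it is `cd₁` there
(`IsCdOne.eq_cdOneUpper`). Since `w² - w⁻² = 2i sin 2z` and the series in `A = i q^(1/2) w` equals
`i L(q^(1/2) w)`, division by `sin 2z` is the claim.

The work lies in the Fourier series of `cd`, which is defined through theta functions, whereas `k`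
and `K` are defined through the hypergeometric function. Two facts are needed.

(a) `k = ϑ₂²/ϑ₃²` and `K = (π/2) ϑ₃²`. Landen's transformation `hypF_landen` and the duplication
formulas for theta constants make `₂F₁(k²) / ϑ₃²` invariant under `s ↦ s²`, so it equals its limit
`1` at `s = 0` (`hypF_thetaModulus_sq`). The transformation `τ ↦ -1/τ` shows that this `k` solves
the equation of the singular modulus; monotonicity of `K` gives uniqueness.

(b) `ϑ₃(z)` times the bilateral Lambert series is a constant multiple of `ϑ₂(z)`
(`thetaEven_mul_oddLambert`), by a recurrence for the Laurent coefficients in `w`. The constant is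
`ϑ₂ ϑ₃ / 2` (`lambertConst_eq`), again by invariance under `s ↦ s²`. -/

open Filter Topology MeasureTheory

/-! ### The hypergeometric series behind `K`. -/

open Finset in
/-- The Taylor coefficients `∏ i < n, (2 i + 1) / (2 i + 2)` of `(1 - x) ^ (-1 / 2)`. -/
noncomputable def invSqrtCoeff (n : ℕ) : ℝ := ∏ i ∈ range n, (2 * (i : ℝ) + 1) / (2 * i + 2)

lemma invSqrtCoeff_zero : invSqrtCoeff 0 = 1 := by simp [invSqrtCoeff]

lemma invSqrtCoeff_succ (n : ℕ) :
    invSqrtCoeff (n + 1) = invSqrtCoeff n * ((2 * (n : ℝ) + 1) / (2 * n + 2)) := by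
  rw [invSqrtCoeff, Finset.prod_range_succ, ← invSqrtCoeff]

lemma invSqrtCoeff_pos (n : ℕ) : 0 < invSqrtCoeff n :=
  Finset.prod_pos fun i _ => by positivity

lemma invSqrtCoeff_le_one (n : ℕ) : invSqrtCoeff n ≤ 1 :=
  Finset.prod_le_one (fun i _ => by positivity) fun i _ => by
    rw [div_le_one (by positivity)]; linarith

lemma choose_neg_half (n : ℕ) :
    Ring.choose (-1 / 2 : ℂ) n = (-1) ^ n * (invSqrtCoeff n : ℂ) := by
  have key : ∀ n : ℕ, (descPochhammer ℤ n).smeval (-1 / 2 : ℂ) =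
      n.factorial * ((-1) ^ n * (invSqrtCoeff n : ℂ)) := by
    intro n
    induction n with
    | zero => simp [invSqrtCoeff]
    | succ n ih =>
      rw [descPochhammer_succ_right, Polynomial.smeval_mul, ih, invSqrtCoeff_succ,
        Nat.factorial_succ]
      have : (2 * (n : ℂ) + 2) ≠ 0 := by exact_mod_cast (by positivity : (2 * (n : ℝ) + 2) ≠ 0)
      simp only [Polynomial.smeval_sub, Polynomial.smeval_X, Polynomial.smeval_natCast]
      push_cast
      field_simp
      simp
      ring
  have h := Ring.descPochhammer_eq_factorial_smul_choose (-1 / 2 : ℂ) n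
  rw [key, nsmul_eq_mul] at h
  exact (mul_left_cancel₀ (by exact_mod_cast n.factorial_ne_zero) h).symm

lemma hasSum_invSqrt {z : ℂ} (hz : ‖z‖ < 1) :
    HasSum (fun n => (invSqrtCoeff n : ℂ) * z ^ n) ((1 - z) ^ (-1 / 2 : ℂ)) := by
  have h := (Complex.one_add_cpow_hasFPowerSeriesOnBall_zero (a := -1 / 2)).hasSum
    (y := -z) (by rw [← ENNReal.ofReal_one, Metric.eball_ofReal]; simpa using hz)
  simp only [binomialSeries_apply, choose_neg_half] at h
  rw [zero_add, ← sub_eq_add_neg] at h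
  convert! h using 2 with n
  rw [List.ofFn_const, List.prod_replicate, smul_eq_mul, neg_pow]
  have : ((-1 : ℂ) ^ n) * (-1) ^ n = 1 := by rw [← mul_pow]; simp
  linear_combination -(invSqrtCoeff n : ℂ) * z ^ n * this

lemma hypergeometric_half_half_one_eq_tsum (x : ℝ) :
    ordinaryHypergeometric (1 / 2 : ℝ) (1 / 2 : ℝ) (1 : ℝ) x =
      ∑' n, invSqrtCoeff n ^ 2 * x ^ n := by
  have key : ∀ n : ℕ, (ascPochhammer ℝ n).eval (1 / 2 : ℝ) = n.factorial * invSqrtCoeff n := by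
    intro n
    induction n with
    | zero => simp [invSqrtCoeff]
    | succ n ih =>
      rw [ascPochhammer_succ_eval, ih, invSqrtCoeff_succ, Nat.factorial_succ]
      push_cast
      field_simp
      ring
  rw [ordinaryHypergeometric_eq_tsum]
  refine tsum_congr fun n => ?_
  have := n.factorial_ne_zero
  rw [smul_eq_mul, key, ascPochhammer_eval_one]
  field_simp

lemma summable_invSqrtCoeff_sq {x : ℝ} (h0 : 0 ≤ x) (h1 : x < 1) :
    Summable fun n => invSqrtCoeff n ^ 2 * x ^ n := by
  refine (summable_geometric_of_lt_one h0 h1).of_nonneg_of_le (fun n => by positivity) fun n => ?_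
  have := pow_le_one₀ (n := 2) (invSqrtCoeff_pos n).le (invSqrtCoeff_le_one n)
  exact mul_le_of_le_one_left (by positivity) this

/-- The function `₂F₁(1/2, 1/2; 1; x)`. -/
noncomputable def hypF (x : ℝ) : ℝ := ∑' n, invSqrtCoeff n ^ 2 * x ^ n

lemma ellipticK_eq (x : ℝ) : ellipticK x = Real.pi / 2 * hypF (x ^ 2) := by
  rw [ellipticK, hypergeometric_half_half_one_eq_tsum, hypF]

lemma hypF_strictMonoOn : StrictMonoOn hypF (Set.Ico 0 1) := by
  intro x hx y hy hxy
  refine Summable.tsum_lt_tsum (i := 1) (fun n => ?_) ?_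
    (summable_invSqrtCoeff_sq hx.1 hx.2) (summable_invSqrtCoeff_sq hy.1 hy.2)
  · have := pow_le_pow_left₀ hx.1 hxy.le n
    have := sq_nonneg (invSqrtCoeff n)
    exact mul_le_mul_of_nonneg_left ‹_› this
  · have := invSqrtCoeff_pos 1
    simp only [pow_one]
    exact mul_lt_mul_of_pos_left hxy (by positivity)

lemma hypF_zero : hypF 0 = 1 := by
  rw [hypF, tsum_eq_single 0 (fun n hn => by simp [hn])]
  simp [invSqrtCoeff_zero]

lemma one_le_hypF {x : ℝ} (h0 : 0 ≤ x) (h1 : x < 1) : 1 ≤ hypF x := by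
  rw [← hypF_zero]
  exact hypF_strictMonoOn.monotoneOn ⟨le_rfl, one_pos⟩ ⟨h0, h1⟩ h0

lemma hypF_le {x : ℝ} (h0 : 0 ≤ x) (h1 : x < 1) : hypF x ≤ (1 - x)⁻¹ := by
  rw [← tsum_geometric_of_lt_one h0 h1]
  refine Summable.tsum_le_tsum (fun n => ?_) (summable_invSqrtCoeff_sq h0 h1)
    (summable_geometric_of_lt_one h0 h1)
  have := pow_le_one₀ (n := 2) (invSqrtCoeff_pos n).le (invSqrtCoeff_le_one n)
  exact mul_le_of_le_one_left (by positivity) this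

lemma hasSum_invSqrt_real {t : ℝ} (h0 : 0 ≤ t) (h1 : t < 1) :
    HasSum (fun n => invSqrtCoeff n * t ^ n) ((1 - t) ^ (-1 / 2 : ℝ)) := by
  have h := hasSum_invSqrt (z := t) (by simpa [abs_of_nonneg h0] using h1)
  rw [← Complex.hasSum_ofReal]
  convert h using 1
  · ext n; push_cast; rfl
  · rw [Complex.ofReal_cpow (by linarith)]; push_cast; rfl

/-! ### Landen's transformation. -/

lemma integral_exp_mul_exp_neg (m n : ℕ) :
    ∫ θ in (0 : ℝ)..2 * Real.pi, Complex.exp (m * (θ * Complex.I)) *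
      Complex.exp (n * (-(θ * Complex.I))) = if m = n then 2 * (Real.pi : ℂ) else 0 := by
  split_ifs with h
  · subst h
    have : ∀ θ : ℝ, Complex.exp (m * (θ * Complex.I)) * Complex.exp (m * (-(θ * Complex.I))) = 1 := by
      intro θ
      rw [← Complex.exp_add]; simp
    simp only [this]
    simp
  · have h' : ((m : ℂ) - n) * Complex.I ≠ 0 :=
      mul_ne_zero (sub_ne_zero.2 (by exact_mod_cast h)) Complex.I_ne_zero
    have : ∀ θ : ℝ, Complex.exp (m * (θ * Complex.I)) * Complex.exp (n * (-(θ * Complex.I))) =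
        Complex.exp ((((m : ℂ) - n) * Complex.I) * θ) := by
      intro θ
      rw [← Complex.exp_add]; ring_nf
    simp only [this]
    rw [integral_exp_mul_complex h']
    have h2 : Complex.exp (((m : ℂ) - n) * Complex.I * ((2 * Real.pi : ℝ) : ℂ)) = 1 := by
      rw [Complex.exp_eq_one_iff]
      exact ⟨(m : ℤ) - n, by push_cast; ring⟩
    rw [h2]; simp

lemma invSqrt_mul_conj {z : ℂ} (hz : ‖z‖ < 1) :
    (1 - z) ^ (-1 / 2 : ℂ) * (1 - (starRingEnd ℂ) z) ^ (-1 / 2 : ℂ) =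
      ((‖1 - z‖⁻¹ : ℝ) : ℂ) := by
  -- `1 - z` lies in the right half-plane, off the branch cut, so the principal power commutes with
  -- conjugation and the product is a squared modulus.
  have hre : 0 < (1 - z).re := by
    have := Complex.re_le_norm z
    simp; linarith
  have harg : (1 - z).arg ≠ Real.pi := by
    intro h
    have := (Complex.arg_eq_pi_iff.1 h).1
    linarith
  have h1 : (1 - (starRingEnd ℂ) z) ^ (-1 / 2 : ℂ) =
      (starRingEnd ℂ) ((1 - z) ^ (-1 / 2 : ℂ)) := by
    have := Complex.cpow_conj (1 - z) (-1 / 2) harg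
    have hr : (starRingEnd ℂ) (-1 / 2 : ℂ) = -1 / 2 := by
      rw [map_div₀, map_neg, map_one, map_ofNat]
    rw [hr, map_sub, map_one] at this
    rw [this, Complex.conj_conj]
  rw [h1, Complex.mul_conj, Complex.normSq_eq_norm_sq]
  have h2 : ‖(1 - z) ^ (-1 / 2 : ℂ)‖ = ‖1 - z‖ ^ (-1 / 2 : ℝ) := by
    have := Complex.norm_cpow_real (1 - z) (-1 / 2)
    rw [← this]; push_cast; rfl
  rw [h2, ← Real.rpow_natCast, ← Real.rpow_mul (norm_nonneg _)]
  norm_num [Real.rpow_neg_one]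

/-- Parseval: with `z = -x e^{iθ}` the integrand is `(1 - z)^(-1/2)` times its conjugate. In the
product of the two binomial series only the diagonal terms survive integration. -/
lemma integral_inv_norm_one_add {x : ℝ} (h0 : 0 ≤ x) (h1 : x < 1) :
    ∫ θ in (0 : ℝ)..2 * Real.pi, ‖1 + x * Complex.exp (θ * Complex.I)‖⁻¹ =
      2 * Real.pi * hypF (x ^ 2) := by
  let F : ℕ × ℕ → ℝ → ℂ := fun p θ =>
    ((invSqrtCoeff p.1 : ℂ) * (-(x * Complex.exp (θ * Complex.I))) ^ p.1) *
      ((invSqrtCoeff p.2 : ℂ) * (-(x * Complex.exp (-(θ * Complex.I)))) ^ p.2)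
  have hgeo : Summable fun n : ℕ => x ^ n := summable_geometric_of_lt_one h0 h1
  have hbs : Summable fun p : ℕ × ℕ => x ^ p.1 * x ^ p.2 :=
    hgeo.mul_of_nonneg hgeo (fun n => by positivity) (fun n => by positivity)
  have hnorm : ∀ θ : ℝ, ‖-(x * Complex.exp (θ * Complex.I))‖ = x := by
    intro θ; simp [Complex.norm_exp_ofReal_mul_I, abs_of_nonneg h0]
  have hnorm' : ∀ θ : ℝ, ‖-(x * Complex.exp (-(θ * Complex.I)))‖ = x := by
    intro θ
    have := hnorm (-θ)
    push_cast at this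
    rwa [neg_mul] at this
  have hterm : ∀ (w : ℂ) (n : ℕ), ‖w‖ = x → ‖(invSqrtCoeff n : ℂ) * w ^ n‖ ≤ x ^ n := by
    intro w n hw
    rw [norm_mul, norm_pow, hw, Complex.norm_real, Real.norm_of_nonneg (invSqrtCoeff_pos n).le]
    exact mul_le_of_le_one_left (by positivity) (invSqrtCoeff_le_one n)
  have hFb : ∀ p θ, ‖F p θ‖ ≤ x ^ p.1 * x ^ p.2 := by
    intro p θ
    rw [norm_mul]
    exact mul_le_mul (hterm _ _ (hnorm θ)) (hterm _ _ (hnorm' θ)) (norm_nonneg _) (by positivity)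
  have hsum : ∀ θ : ℝ, HasSum (fun p => F p θ)
      ((‖1 + x * Complex.exp (θ * Complex.I)‖⁻¹ : ℝ) : ℂ) := by
    intro θ
    have hz : ‖-(x * Complex.exp (θ * Complex.I))‖ < 1 := by rw [hnorm]; exact h1
    have hz' : ‖-(x * Complex.exp (-(θ * Complex.I)))‖ < 1 := by rw [hnorm']; exact h1
    have hc : (starRingEnd ℂ) (-(x * Complex.exp (θ * Complex.I))) =
        -(x * Complex.exp (-(θ * Complex.I))) := by
      rw [map_neg, map_mul, Complex.conj_ofReal, ← Complex.exp_conj]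
      simp
    have := (hasSum_invSqrt hz).mul (hasSum_invSqrt hz')
      (hbs.of_norm_bounded (fun p => hFb p θ))
    rw [← hc, invSqrt_mul_conj hz, sub_neg_eq_add, hc] at this
    exact this
  have hint := intervalIntegral.hasSum_integral_of_dominated_convergence (μ := volume)
    (a := 0) (b := 2 * Real.pi) (F := F) (fun p _ => x ^ p.1 * x ^ p.2)
    (fun p => by
      apply Continuous.aestronglyMeasurable
      simp only [F]; fun_prop)
    (fun p => Filter.Eventually.of_forall fun θ _ => hFb p θ)
    (Filter.Eventually.of_forall fun θ _ => hbs)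
    (by simp)
    (Filter.Eventually.of_forall fun θ _ => hsum θ)
  have hFint : ∀ p : ℕ × ℕ, ∫ θ in (0 : ℝ)..2 * Real.pi, F p θ =
      if p.1 = p.2 then ((2 * Real.pi * (invSqrtCoeff p.1 ^ 2 * (x ^ 2) ^ p.1) : ℝ) : ℂ)
        else 0 := by
    intro p
    have : ∀ θ : ℝ, F p θ = ((invSqrtCoeff p.1 : ℂ) * invSqrtCoeff p.2 * (-x) ^ p.1 * (-x) ^ p.2) *
        (Complex.exp (p.1 * (θ * Complex.I)) * Complex.exp (p.2 * (-(θ * Complex.I)))) := by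
      intro θ
      simp only [F]
      rw [Complex.exp_nat_mul, Complex.exp_nat_mul, ← neg_mul, ← neg_mul, mul_pow, mul_pow]
      ring
    simp only [this]
    rw [intervalIntegral.integral_const_mul, integral_exp_mul_exp_neg]
    split_ifs with h
    · have hx : (-(x : ℂ)) ^ p.1 * (-(x : ℂ)) ^ p.1 = ((x : ℂ) ^ 2) ^ p.1 := by
        rw [← mul_pow]; congr 1; ring
      rw [← h]
      push_cast
      rw [← hx]; ring
    · simp
  simp only [hFint] at hint
  have h2 : HasSum (fun p : ℕ × ℕ => if p.1 = p.2 then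
      ((2 * Real.pi * (invSqrtCoeff p.1 ^ 2 * (x ^ 2) ^ p.1) : ℝ) : ℂ) else 0)
      ((2 * Real.pi * hypF (x ^ 2) : ℝ) : ℂ) := by
    have hx2 : x ^ 2 < 1 := pow_lt_one₀ h0 h1 two_ne_zero
    have hd := ((summable_invSqrtCoeff_sq (sq_nonneg x) hx2).hasSum.mul_left (2 * Real.pi))
    have hd := Complex.hasSum_ofReal.2 hd
    have hinj : Function.Injective (fun n : ℕ => (n, n)) := fun a b h => (Prod.ext_iff.1 h).1
    rw [← hinj.hasSum_iff]
    · simpa [Function.comp_def, hypF] using hd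
    · rintro ⟨a, b⟩ hab
      rw [if_neg]
      intro h
      exact hab ⟨a, Prod.ext rfl h⟩
  have h3 := hint.unique h2
  rw [intervalIntegral.integral_ofReal] at h3
  exact_mod_cast h3

lemma norm_one_add_mul_exp {x : ℝ} (h0 : 0 ≤ x) (θ : ℝ) :
    ‖1 + x * Complex.exp (θ * Complex.I)‖ ^ 2 =
      (1 + x) ^ 2 * (1 - 4 * x / (1 + x) ^ 2 * Real.sin (θ / 2) ^ 2) := by
  have h : (1 + x) ≠ 0 := by positivity
  have h1 : (1 + x) ^ 2 * (1 - 4 * x / (1 + x) ^ 2 * Real.sin (θ / 2) ^ 2) =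
      (1 + x) ^ 2 - 4 * x * Real.sin (θ / 2) ^ 2 := by field_simp
  have hc : Real.cos θ = 1 - 2 * Real.sin (θ / 2) ^ 2 := by
    have := Real.cos_two_mul (θ / 2)
    rw [Real.cos_sq', mul_div_cancel₀ θ two_ne_zero] at this
    linarith
  rw [h1, ← Complex.normSq_eq_norm_sq, Complex.exp_mul_I, ← Complex.ofReal_cos,
    ← Complex.ofReal_sin, Complex.normSq_apply]
  simp only [Complex.add_re, Complex.one_re, Complex.mul_re, Complex.ofReal_re, Complex.I_re,
    Complex.ofReal_im, Complex.I_im, Complex.add_im, Complex.one_im, Complex.mul_im]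
  have := Real.sin_sq_add_cos_sq θ
  nlinarith [this, hc]

/-- The same integral, now through `|1 + x e^{iθ}|² = (1 + x)² (1 - m sin²(θ/2))` and termwise
integration of the binomial series in `m`. -/
lemma integral_inv_norm_one_add' {x : ℝ} (h0 : 0 ≤ x) (h1 : x < 1) :
    ∫ θ in (0 : ℝ)..2 * Real.pi, ‖1 + x * Complex.exp (θ * Complex.I)‖⁻¹ =
      (1 + x)⁻¹ * (2 * Real.pi * hypF (4 * x / (1 + x) ^ 2)) := by
  set m := 4 * x / (1 + x) ^ 2 with hm
  have hm0 : 0 ≤ m := by positivity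
  have hm1 : m < 1 := by
    rw [hm, div_lt_one (by positivity)]
    nlinarith [sq_pos_of_pos (sub_pos.2 h1)]
  have hms : ∀ θ : ℝ, m * Real.sin (θ / 2) ^ 2 ≤ m := fun θ =>
    mul_le_of_le_one_right hm0 (Real.sin_sq_le_one _)
  have hI : ∀ θ : ℝ, ‖1 + x * Complex.exp (θ * Complex.I)‖⁻¹ =
      (1 + x)⁻¹ * (1 - m * Real.sin (θ / 2) ^ 2) ^ (-1 / 2 : ℝ) := by
    intro θ
    have hpos : 0 < 1 - m * Real.sin (θ / 2) ^ 2 := by linarith [hms θ]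
    have h := norm_one_add_mul_exp h0 θ
    have h2 : ‖1 + x * Complex.exp (θ * Complex.I)‖ =
        (1 + x) * Real.sqrt (1 - m * Real.sin (θ / 2) ^ 2) := by
      rw [← Real.sqrt_sq (norm_nonneg (1 + x * Complex.exp (θ * Complex.I))), h,
        Real.sqrt_mul (by positivity), Real.sqrt_sq (by positivity)]
    rw [h2, mul_inv, Real.sqrt_eq_rpow, ← Real.rpow_neg hpos.le]
    norm_num
  simp only [hI]
  rw [intervalIntegral.integral_const_mul]
  congr 1
  have hint := intervalIntegral.hasSum_integral_of_dominated_convergence (μ := volume)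
    (a := 0) (b := 2 * Real.pi)
    (F := fun (n : ℕ) (θ : ℝ) => invSqrtCoeff n * (m * Real.sin (θ / 2) ^ 2) ^ n)
    (f := fun θ => (1 - m * Real.sin (θ / 2) ^ 2) ^ (-1 / 2 : ℝ))
    (fun n _ => m ^ n)
    (fun n => by
      apply Continuous.aestronglyMeasurable
      fun_prop)
    (fun n => Filter.Eventually.of_forall fun θ _ => by
      have h : 0 ≤ m * Real.sin (θ / 2) ^ 2 := by positivity
      rw [Real.norm_of_nonneg (mul_nonneg (invSqrtCoeff_pos n).le (pow_nonneg h n))]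
      calc _ ≤ 1 * (m * Real.sin (θ / 2) ^ 2) ^ n :=
            mul_le_mul_of_nonneg_right (invSqrtCoeff_le_one n) (pow_nonneg h n)
        _ ≤ m ^ n := by rw [one_mul]; exact pow_le_pow_left₀ h (hms θ) n)
    (Filter.Eventually.of_forall fun θ _ => summable_geometric_of_lt_one hm0 hm1)
    (by simp)
    (Filter.Eventually.of_forall fun θ _ =>
      hasSum_invSqrt_real (by positivity) (by linarith [hms θ]))
  have hFint : ∀ n : ℕ, ∫ θ in (0 : ℝ)..2 * Real.pi,
      invSqrtCoeff n * (m * Real.sin (θ / 2) ^ 2) ^ n =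
        2 * Real.pi * (invSqrtCoeff n ^ 2 * m ^ n) := by
    intro n
    have : ∀ θ : ℝ, invSqrtCoeff n * (m * Real.sin (θ / 2) ^ 2) ^ n =
        (invSqrtCoeff n * m ^ n) * (fun t => Real.sin t ^ (2 * n)) (θ / 2) := by
      intro θ
      simp only
      rw [mul_pow, ← pow_mul]; ring
    simp only [this]
    rw [intervalIntegral.integral_const_mul,
      intervalIntegral.integral_comp_div (fun t => Real.sin t ^ (2 * n)) two_ne_zero]
    simp only [zero_div, mul_div_cancel_left₀ Real.pi (two_ne_zero (α := ℝ))]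
    -- Wallis' product is the same product of odd over even numbers, which produces the second
    -- factor `invSqrtCoeff n`.
    rw [integral_sin_pow_even, ← invSqrtCoeff, smul_eq_mul]
    ring
  simp only [hFint] at hint
  exact hint.unique ((summable_invSqrtCoeff_sq hm0 hm1).hasSum.mul_left _)

/-- **Landen's transformation** of the complete elliptic integral. -/
lemma hypF_landen {x : ℝ} (h0 : 0 ≤ x) (h1 : x < 1) :
    hypF (4 * x / (1 + x) ^ 2) = (1 + x) * hypF (x ^ 2) := by
  -- Equate the two evaluations of the integral.
  have h := (integral_inv_norm_one_add' h0 h1).symm.trans (integral_inv_norm_one_add h0 h1)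
  have hp := Real.pi_pos
  field_simp at h
  rw [mul_comm 4 x]
  exact h

/-! ### Theta series in `s = q^(1/4)`, which keeps all exponents integral, and duplication of theta
constants. -/

lemma summable_gauss {s : ℝ} (h0 : 0 < s) (h1 : s < 1) {w : ℂ} (hw : w ≠ 0) :
    Summable fun n : ℤ => (s : ℂ) ^ (n ^ 2) * w ^ n := by
  have hpi : (Real.pi : ℂ) ≠ 0 := by exact_mod_cast Real.pi_ne_zero
  have h := (summable_jacobiTheta₂_term_iff (Complex.log w / (2 * Real.pi * Complex.I))
    (((-Real.log s / Real.pi : ℝ) : ℂ) * Complex.I)).2 (by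
      have := Real.log_neg h0 h1
      simpa using div_pos (neg_pos.2 this) Real.pi_pos)
  convert h using 2 with n
  have hs : (s : ℂ) = Complex.exp (Real.log s) := by
    rw [← Complex.ofReal_exp, Real.exp_log h0]
  rw [jacobiTheta₂_term, Complex.exp_add, hs, ← Complex.exp_int_mul]
  nth_rewrite 1 [← Complex.exp_log hw]
  rw [← Complex.exp_int_mul, mul_comm]
  congr 2
  · field_simp
  · push_cast
    field_simp
    linear_combination (n : ℂ) ^ 2 * (Real.log s) * Complex.I_sq

/-- The theta function `∑ s ^ (2 n) ^ 2 w ^ (2 n)`, summed over all integers `n`. -/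
noncomputable def thetaEven (s : ℝ) (w : ℂ) : ℂ := ∑' n : ℤ, (s : ℂ) ^ (4 * n ^ 2) * w ^ (2 * n)

/-- The theta function `∑ s ^ (2 n + 1) ^ 2 w ^ (2 n + 1)`, summed over all integers `n`. -/
noncomputable def thetaOdd (s : ℝ) (w : ℂ) : ℂ :=
  ∑' n : ℤ, (s : ℂ) ^ ((2 * n + 1) ^ 2) * w ^ (2 * n + 1)

lemma summable_thetaEven {s : ℝ} (h0 : 0 < s) (h1 : s < 1) {w : ℂ} (hw : w ≠ 0) :
    Summable fun n : ℤ => (s : ℂ) ^ (4 * n ^ 2) * w ^ (2 * n) := by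
  convert summable_gauss (s := s ^ 4) (w := w ^ 2) (by positivity)
    (pow_lt_one₀ h0.le h1 (by norm_num)) (pow_ne_zero _ hw) using 2 with n
  rw [zpow_mul, zpow_mul]; norm_cast

lemma summable_thetaOdd {s : ℝ} (h0 : 0 < s) (h1 : s < 1) {w : ℂ} (hw : w ≠ 0) :
    Summable fun n : ℤ => (s : ℂ) ^ ((2 * n + 1) ^ 2) * w ^ (2 * n + 1) := by
  have hs : (s : ℂ) ≠ 0 := by exact_mod_cast h0.ne'
  convert! (summable_gauss (s := s ^ 4) (w := (s : ℂ) ^ 4 * w ^ 2) (by positivity)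
    (pow_lt_one₀ h0.le h1 (by norm_num)) (by positivity)).mul_left (s * w) using 2 with n
  rw [show (2 * n + 1) ^ 2 = 4 * n ^ 2 + 4 * n + 1 by ring, zpow_add₀ hs, zpow_add₀ hs,
    zpow_add₀ hw, mul_zpow, zpow_mul, zpow_mul, zpow_mul, zpow_one, zpow_one,
    zpow_ofNat (s : ℂ) 4, zpow_ofNat w 2, Complex.ofReal_pow]
  ring

/-- The theta constant `ϑ₃ = ∑ s ^ (2 n) ^ 2`. -/
noncomputable def thetaThree (s : ℝ) : ℝ := ∑' n : ℤ, s ^ (4 * n ^ 2)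

/-- The theta constant `ϑ₂ = ∑ s ^ (2 n + 1) ^ 2`. -/
noncomputable def thetaTwo (s : ℝ) : ℝ := ∑' n : ℤ, s ^ ((2 * n + 1) ^ 2)

/-- The theta constant `ϑ₄ = ∑ (-1) ^ n s ^ (2 n) ^ 2`. -/
noncomputable def thetaFour (s : ℝ) : ℝ := ∑' n : ℤ, (-1) ^ n * s ^ (4 * n ^ 2)

lemma summable_thetaThree {s : ℝ} (h0 : 0 < s) (h1 : s < 1) :
    Summable fun n : ℤ => s ^ (4 * n ^ 2) := by
  have h := summable_thetaEven h0 h1 one_ne_zero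
  simp only [one_zpow, mul_one] at h
  exact_mod_cast h

lemma summable_thetaTwo {s : ℝ} (h0 : 0 < s) (h1 : s < 1) :
    Summable fun n : ℤ => s ^ ((2 * n + 1) ^ 2) := by
  have h := summable_thetaOdd h0 h1 one_ne_zero
  simp only [one_zpow, mul_one] at h
  exact_mod_cast h

lemma abs_neg_one_zpow_mul (n : ℤ) (x : ℝ) : |(-1) ^ n * x| = |x| := by
  rw [abs_mul, abs_zpow]; simp

lemma summable_thetaFour {s : ℝ} (h0 : 0 < s) (h1 : s < 1) :
    Summable fun n : ℤ => (-1) ^ n * s ^ (4 * n ^ 2) :=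
  (summable_thetaThree h0 h1).of_norm_bounded fun n => by
    rw [Real.norm_eq_abs, abs_neg_one_zpow_mul, abs_of_pos (zpow_pos h0 _)]

lemma thetaEven_one (s : ℝ) : thetaEven s 1 = thetaThree s := by
  rw [thetaEven, thetaThree, Complex.ofReal_tsum]
  simp

lemma thetaOdd_one (s : ℝ) : thetaOdd s 1 = thetaTwo s := by
  rw [thetaOdd, thetaTwo, Complex.ofReal_tsum]
  simp

lemma thetaEven_I (s : ℝ) : thetaEven s Complex.I = thetaFour s := by
  rw [thetaEven, thetaFour, Complex.ofReal_tsum]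
  refine tsum_congr fun n => ?_
  rw [zpow_mul Complex.I, zpow_ofNat, Complex.I_sq, mul_comm]
  push_cast
  rfl

lemma thetaThree_pos {s : ℝ} (h0 : 0 < s) (h1 : s < 1) : 0 < thetaThree s :=
  (summable_thetaThree h0 h1).tsum_pos (fun _ => (zpow_pos h0 _).le) 0 (zpow_pos h0 _)

lemma thetaTwo_pos {s : ℝ} (h0 : 0 < s) (h1 : s < 1) : 0 < thetaTwo s :=
  (summable_thetaTwo h0 h1).tsum_pos (fun _ => (zpow_pos h0 _).le) 0 (zpow_pos h0 _)

/-- Splitting a double series over `ℤ × ℤ` by the parity of the sum of the two indices. -/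
lemma tsum_int_prod_parity {f : ℤ × ℤ → ℝ} (hf : Summable f) :
    ∑' p, f p = ∑' p : ℤ × ℤ, f (p.1 + p.2, p.1 - p.2) +
      ∑' p : ℤ × ℤ, f (p.1 + p.2 + 1, p.1 - p.2) := by
  let g₀ : ℤ × ℤ → ℤ × ℤ := fun p => (p.1 + p.2, p.1 - p.2)
  let g₁ : ℤ × ℤ → ℤ × ℤ := fun p => (p.1 + p.2 + 1, p.1 - p.2)
  have i₀ : Function.Injective g₀ := by
    rintro ⟨a, b⟩ ⟨c, d⟩ h
    simp only [g₀, Prod.mk.injEq] at h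
    ext <;> simp only <;> omega
  have i₁ : Function.Injective g₁ := by
    rintro ⟨a, b⟩ ⟨c, d⟩ h
    simp only [g₁, Prod.mk.injEq] at h
    ext <;> simp only <;> omega
  have hc : IsCompl (Set.range g₀) (Set.range g₁) := by
    constructor
    · rw [Set.disjoint_left]
      rintro _ ⟨⟨a, b⟩, rfl⟩ ⟨⟨c, d⟩, h⟩
      simp only [g₀, g₁, Prod.mk.injEq] at h
      omega
    · rw [codisjoint_iff_le_sup]
      rintro ⟨a, b⟩ -
      rcases Int.even_or_odd' (a + b) with ⟨k, hk | hk⟩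
      · exact Or.inl ⟨(k, a - k), by simp only [g₀, Prod.mk.injEq]; omega⟩
      · exact Or.inr ⟨(k, a - k - 1), by simp only [g₁, Prod.mk.injEq]; omega⟩
  have h := ((i₀.hasSum_range_iff (f := f)).2 (hf.comp_injective i₀).hasSum).add_isCompl hc
    ((i₁.hasSum_range_iff (f := f)).2 (hf.comp_injective i₁).hasSum)
  exact h.tsum_eq

lemma tsum_mul_tsum_parity {a b : ℤ → ℝ} (ha : Summable a) (hb : Summable b) :
    (∑' n, a n) * ∑' n, b n = ∑' p : ℤ × ℤ, a (p.1 + p.2) * b (p.1 - p.2) +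
      ∑' p : ℤ × ℤ, a (p.1 + p.2 + 1) * b (p.1 - p.2) := by
  rw [tsum_mul_tsum_of_summable_norm ha.norm hb.norm,
    tsum_int_prod_parity (summable_mul_of_summable_norm ha.norm hb.norm)]

lemma tsum_mul_tsum_int {a b : ℤ → ℝ} (ha : Summable a) (hb : Summable b) :
    (∑' n, a n) * ∑' n, b n = ∑' p : ℤ × ℤ, a p.1 * b p.2 :=
  tsum_mul_tsum_of_summable_norm ha.norm hb.norm

/-- Rotate the lattice by `(a + b)² + (a - b)² = 2a² + 2b²`: index pairs with even sum give the `ϑ₃`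
term, those with odd sum the `ϑ₂` term. -/
lemma thetaThree_sq {s : ℝ} (h0 : 0 < s) (h1 : s < 1) :
    thetaThree s ^ 2 = thetaThree (s ^ 2) ^ 2 + thetaTwo (s ^ 2) ^ 2 := by
  have g0 : 0 < s ^ 2 := by positivity
  have g1 : s ^ 2 < 1 := pow_lt_one₀ h0.le h1 two_ne_zero
  have hs := h0.ne'
  simp only [sq (thetaThree _), sq (thetaTwo _)]
  rw [thetaThree, thetaThree, thetaTwo,
    tsum_mul_tsum_parity (summable_thetaThree h0 h1) (summable_thetaThree h0 h1),
    tsum_mul_tsum_int (summable_thetaThree g0 g1) (summable_thetaThree g0 g1),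
    tsum_mul_tsum_int (summable_thetaTwo g0 g1) (summable_thetaTwo g0 g1)]
  congr 1 <;> refine tsum_congr fun p => ?_ <;>
  · rw [← zpow_add₀ hs, ← zpow_add₀ g0.ne', ← zpow_natCast s 2, ← zpow_mul]
    congr 1
    push_cast; ring

/-- The same rotation; the product of signs is `1` when the indices have even sum and `-1` when they
have odd sum. -/
lemma thetaFour_sq {s : ℝ} (h0 : 0 < s) (h1 : s < 1) :
    thetaFour s ^ 2 = thetaThree (s ^ 2) ^ 2 - thetaTwo (s ^ 2) ^ 2 := by
  have g0 : 0 < s ^ 2 := by positivity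
  have g1 : s ^ 2 < 1 := pow_lt_one₀ h0.le h1 two_ne_zero
  have hs := h0.ne'
  simp only [sq (thetaThree _), sq (thetaTwo _), sq (thetaFour _)]
  rw [thetaThree, thetaFour, thetaTwo, sub_eq_add_neg,
    tsum_mul_tsum_parity (summable_thetaFour h0 h1) (summable_thetaFour h0 h1),
    tsum_mul_tsum_int (summable_thetaThree g0 g1) (summable_thetaThree g0 g1),
    tsum_mul_tsum_int (summable_thetaTwo g0 g1) (summable_thetaTwo g0 g1), ← tsum_neg]
  congr 1 <;> refine tsum_congr fun p => ?_
  · rw [mul_mul_mul_comm, ← zpow_add₀ hs, ← zpow_add₀ g0.ne', ← zpow_natCast s 2, ← zpow_mul,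
      ← zpow_add₀ (by norm_num), Even.neg_one_zpow ⟨p.1, by ring⟩, one_mul]
    congr 1
    push_cast; ring
  · rw [mul_mul_mul_comm, ← zpow_add₀ hs, ← zpow_add₀ g0.ne', ← zpow_natCast s 2, ← zpow_mul,
      ← zpow_add₀ (by norm_num), Odd.neg_one_zpow ⟨p.1, by ring⟩, neg_one_mul]
    congr 2
    push_cast; ring

lemma thetaTwo_sq {s : ℝ} (h0 : 0 < s) (h1 : s < 1) :
    thetaTwo s ^ 2 = 2 * thetaTwo (s ^ 2) * thetaThree (s ^ 2) := by
  have g0 : 0 < s ^ 2 := by positivity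
  have g1 : s ^ 2 < 1 := pow_lt_one₀ h0.le h1 two_ne_zero
  have hs := h0.ne'
  rw [mul_assoc, two_mul, sq, thetaThree, thetaTwo, thetaTwo,
    tsum_mul_tsum_parity (summable_thetaTwo h0 h1) (summable_thetaTwo h0 h1)]
  congr 1
  · rw [tsum_mul_tsum_int (summable_thetaTwo g0 g1) (summable_thetaThree g0 g1)]
    refine tsum_congr fun p => ?_
    rw [← zpow_add₀ hs, ← zpow_add₀ g0.ne', ← zpow_natCast s 2, ← zpow_mul]
    congr 1
    push_cast; ring
  -- In the odd class the first square is `(2a + 2)²`; shifting `a` by one turns it into the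
  -- exponent of `ϑ₃`.
  · rw [mul_comm, tsum_mul_tsum_int (summable_thetaThree g0 g1) (summable_thetaTwo g0 g1),
      ← ((Equiv.addRight (1 : ℤ)).prodCongr (Equiv.refl ℤ)).tsum_eq
        (fun p : ℤ × ℤ => (s ^ 2) ^ (4 * p.1 ^ 2) * (s ^ 2) ^ ((2 * p.2 + 1) ^ 2))]
    refine tsum_congr fun p => ?_
    rw [← zpow_add₀ hs, ← zpow_add₀ g0.ne', ← zpow_natCast s 2, ← zpow_mul]
    congr 1
    simp
    ring

/-- **Jacobi's identity** for the theta constants. -/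
lemma thetaThree_pow_four {s : ℝ} (h0 : 0 < s) (h1 : s < 1) :
    thetaThree s ^ 4 = thetaTwo s ^ 4 + thetaFour s ^ 4 := by
  have h3 := thetaThree_sq h0 h1
  have h2 := thetaTwo_sq h0 h1
  have h4 := thetaFour_sq h0 h1
  rw [show thetaThree s ^ 4 = (thetaThree s ^ 2) ^ 2 by ring,
    show thetaTwo s ^ 4 = (thetaTwo s ^ 2) ^ 2 by ring,
    show thetaFour s ^ 4 = (thetaFour s ^ 2) ^ 2 by ring, h2, h3, h4]
  ring

/-! ### Limits at `s = 0` and invariance under `s ↦ s²`. -/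

lemma tendsto_zpow_nhdsGT_zero {k : ℤ} (hk : 0 < k) :
    Tendsto (fun s : ℝ => s ^ k) (𝓝[>] 0) (𝓝 0) := by
  lift k to ℕ using hk.le
  have h : Tendsto (fun s : ℝ => s ^ k) (𝓝 0) (𝓝 (0 ^ k)) := (continuous_pow k).tendsto 0
  rw [zero_pow (by omega)] at h
  simpa using h.mono_left nhdsWithin_le_nhds

lemma zpow_le_half_zpow {s : ℝ} (h0 : 0 < s) (h1 : s < 1 / 2) {k : ℤ} (hk : 0 ≤ k) :
    s ^ k ≤ (1 / 2 : ℝ) ^ k := by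
  lift k to ℕ using hk
  simpa using pow_le_pow_left₀ h0.le h1.le k

lemma eventually_mem_Ioo_zero_half : ∀ᶠ s : ℝ in 𝓝[>] 0, s ∈ Set.Ioo (0 : ℝ) (1 / 2) :=
  Ioo_mem_nhdsGT (by norm_num)

lemma tendsto_thetaThree : Tendsto thetaThree (𝓝[>] 0) (𝓝 1) := by
  have h := tendsto_tsum_of_dominated_convergence (𝓕 := 𝓝[>] (0 : ℝ))
    (f := fun (s : ℝ) (n : ℤ) => s ^ (4 * n ^ 2)) (g := fun n => if n = 0 then (1 : ℝ) else 0)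
    (summable_thetaThree (s := 1 / 2) (by norm_num) (by norm_num))
    (fun n => by
      split_ifs with hn
      · simp [hn]
      · exact tendsto_zpow_nhdsGT_zero (by positivity))
    (by
      filter_upwards [eventually_mem_Ioo_zero_half] with s hs n
      rw [Real.norm_of_nonneg (zpow_pos hs.1 _).le]
      exact zpow_le_half_zpow hs.1 hs.2 (by positivity))
  rwa [tsum_ite_eq] at h

lemma zpow_odd_sq_div {s : ℝ} (h0 : 0 < s) (n : ℤ) :
    s ^ ((2 * n + 1) ^ 2) / s = s ^ (4 * (n * (n + 1))) := by
  rw [div_eq_iff h0.ne', ← zpow_add_one₀ h0.ne']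
  congr 1; ring

lemma int_mul_succ_nonneg (n : ℤ) : 0 ≤ n * (n + 1) := by
  rcases le_or_gt 0 n with h | h
  · positivity
  · exact mul_nonneg_of_nonpos_of_nonpos h.le (by omega)

lemma int_mul_succ_pos {n : ℤ} (h0 : n ≠ 0) (h1 : n ≠ -1) : 0 < n * (n + 1) :=
  (int_mul_succ_nonneg n).lt_of_ne' (mul_ne_zero h0 (by omega))

lemma summable_half_zpow : Summable fun n : ℤ => (1 / 2 : ℝ) ^ (4 * (n * (n + 1))) := by
  have h := (summable_thetaTwo (s := 1 / 2) (by norm_num) (by norm_num)).div_const (1 / 2 : ℝ)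
  simpa only [zpow_odd_sq_div (s := 1 / 2) (by norm_num)] using h

lemma tendsto_thetaTwo_div : Tendsto (fun s => thetaTwo s / s) (𝓝[>] 0) (𝓝 2) := by
  have h := tendsto_tsum_of_dominated_convergence (𝓕 := 𝓝[>] (0 : ℝ))
    (f := fun (s : ℝ) (n : ℤ) => s ^ ((2 * n + 1) ^ 2) / s)
    -- Exactly the indices `0` and `-1` have `(2n + 1)² = 1`, whence the limit `2`.
    (g := fun n => (if n = 0 then (1 : ℝ) else 0) + if n = -1 then (1 : ℝ) else 0)
    summable_half_zpow
    (fun n => by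
      have hev : (fun s : ℝ => s ^ (4 * (n * (n + 1)))) =ᶠ[𝓝[>] 0]
          fun s : ℝ => s ^ ((2 * n + 1) ^ 2) / s := by
        filter_upwards [self_mem_nhdsWithin] with s hs using (zpow_odd_sq_div hs n).symm
      refine Tendsto.congr' hev ?_
      by_cases hn : n = 0
      · simp [hn]
      by_cases hn' : n = -1
      · simp [hn']
      rw [if_neg hn, if_neg hn', add_zero]
      have := int_mul_succ_pos hn hn'
      exact tendsto_zpow_nhdsGT_zero (by positivity))
    (by
      filter_upwards [eventually_mem_Ioo_zero_half] with s hs n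
      rw [zpow_odd_sq_div hs.1, Real.norm_of_nonneg (zpow_pos hs.1 _).le]
      have := int_mul_succ_nonneg n
      exact zpow_le_half_zpow hs.1 hs.2 (by positivity))
  rw [Summable.tsum_add (summable_of_ne_finset_zero (s := {0}) (by simp_all))
    (summable_of_ne_finset_zero (s := {-1}) (by simp_all)), tsum_ite_eq, tsum_ite_eq] at h
  norm_num at h
  simpa only [thetaTwo, tsum_div_const] using h

lemma tendsto_pow_two_pow {s : ℝ} (h0 : 0 < s) (h1 : s < 1) :
    Tendsto (fun k : ℕ => s ^ 2 ^ k) atTop (𝓝[>] 0) := by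
  refine tendsto_nhdsWithin_iff.2 ⟨?_, Eventually.of_forall fun k => pow_pos h0 _⟩
  exact (tendsto_pow_atTop_nhds_zero_of_lt_one h0.le h1).comp
    (tendsto_pow_atTop_atTop_of_one_lt one_lt_two)

/-- A function that is invariant under `s ↦ s ^ 2` is equal to its limit at zero. -/
lemma eq_of_tendsto_of_invariant {f : ℝ → ℝ} {l : ℝ} (hf : Tendsto f (𝓝[>] 0) (𝓝 l))
    (hinv : ∀ s, 0 < s → s < 1 → f (s ^ 2) = f s) {s : ℝ} (h0 : 0 < s) (h1 : s < 1) :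
    f s = l := by
  have h : ∀ k : ℕ, f (s ^ 2 ^ k) = f s := by
    intro k
    induction k with
    | zero => simp
    | succ k ih =>
      rw [pow_succ, pow_mul, hinv _ (pow_pos h0 _) (pow_lt_one₀ h0.le h1 (by positivity)), ih]
  have h2 := hf.comp (tendsto_pow_two_pow h0 h1)
  simp only [Function.comp_def, h] at h2
  exact tendsto_nhds_unique tendsto_const_nhds h2

/-! ### The nome and the transformation `τ ↦ -1/τ`, that is `r ↦ 1/r`. -/

/-- The fourth root `exp (-π √r / 4)` of the nome. -/
noncomputable def quarterNome (r : ℝ) : ℝ := Real.exp (-Real.pi * Real.sqrt r / 4)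

lemma quarterNome_pos (r : ℝ) : 0 < quarterNome r := Real.exp_pos _

lemma quarterNome_lt_one {r : ℝ} (hr : 0 < r) : quarterNome r < 1 := by
  rw [quarterNome, Real.exp_lt_one_iff]
  have := mul_pos Real.pi_pos (Real.sqrt_pos.2 hr)
  linarith

lemma quarterNome_pow_four (r : ℝ) : quarterNome r ^ 4 = nome r := by
  rw [quarterNome, nome, ← Real.exp_nat_mul]
  congr 1; push_cast; ring

lemma quarterNome_zpow (r : ℝ) (k : ℤ) :
    (quarterNome r : ℂ) ^ k = Complex.exp (Real.pi * Complex.I * nomeTau r * k / 4) := by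
  rw [quarterNome, Complex.ofReal_exp, ← Complex.exp_int_mul]
  congr 1
  rw [nomeTau]
  push_cast
  linear_combination -(k * Real.pi * Real.sqrt r / 4 : ℂ) * Complex.I_sq

lemma theta3_eq_thetaEven (r : ℝ) (z : ℂ) :
    theta3 r z = thetaEven (quarterNome r) (Complex.exp (Complex.I * z)) := by
  have hpi : (Real.pi : ℂ) ≠ 0 := by exact_mod_cast Real.pi_ne_zero
  refine tsum_congr fun n => ?_
  rw [jacobiTheta₂_term, quarterNome_zpow, ← Complex.exp_int_mul, ← Complex.exp_add]
  congr 1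
  push_cast
  field_simp
  ring

lemma theta2_eq_thetaOdd (r : ℝ) (z : ℂ) :
    theta2 r z = thetaOdd (quarterNome r) (Complex.exp (Complex.I * z)) := by
  have hpi : (Real.pi : ℂ) ≠ 0 := by exact_mod_cast Real.pi_ne_zero
  rw [theta2, jacobiTheta₂, ← tsum_mul_left]
  refine tsum_congr fun n => ?_
  rw [jacobiTheta₂_term, quarterNome_zpow, ← Complex.exp_int_mul, ← Complex.exp_add,
    ← Complex.exp_add]
  congr 1
  push_cast
  field_simp
  ring

lemma theta3_zero (r : ℝ) : theta3 r 0 = thetaThree (quarterNome r) := by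
  rw [theta3_eq_thetaEven, mul_zero, Complex.exp_zero, thetaEven_one]

lemma theta2_zero (r : ℝ) : theta2 r 0 = thetaTwo (quarterNome r) := by
  rw [theta2_eq_thetaOdd, mul_zero, Complex.exp_zero, thetaOdd_one]

lemma theta3_pi_div_two (r : ℝ) : theta3 r (Real.pi / 2) = thetaFour (quarterNome r) := by
  rw [theta3_eq_thetaEven, mul_comm, Complex.exp_pi_div_two_mul_I, thetaEven_I]

lemma neg_one_div_nomeTau {r : ℝ} (hr : 0 < r) : -1 / nomeTau r = nomeTau r⁻¹ := by
  have h : (Real.sqrt r : ℂ) ≠ 0 := by exact_mod_cast (Real.sqrt_pos.2 hr).ne'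
  rw [nomeTau, nomeTau, Real.sqrt_inv]
  push_cast
  field_simp
  rw [Complex.I_sq]

lemma sqrt_cpow_half_sq (r : ℝ) :
    ((-Complex.I * nomeTau r) ^ (1 / 2 : ℂ)) ^ 2 = (Real.sqrt r : ℂ) := by
  have h : -Complex.I * nomeTau r = (Real.sqrt r : ℂ) := by
    rw [nomeTau]; linear_combination -(Real.sqrt r : ℂ) * Complex.I_sq
  rw [h, ← Complex.cpow_nat_mul]
  norm_num

/-- The functional equation at `z = 0`. Squaring replaces the factor `(-iτ)^(1/2)` by `√r`. -/
lemma thetaThree_quarterNome_inv {r : ℝ} (hr : 0 < r) :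
    thetaThree (quarterNome r⁻¹) ^ 2 = Real.sqrt r * thetaThree (quarterNome r) ^ 2 := by
  have h := jacobiTheta₂_functional_equation 0 (nomeTau r)
  rw [neg_one_div_nomeTau hr] at h
  have e : ∀ r : ℝ, jacobiTheta₂ 0 (nomeTau r) = thetaThree (quarterNome r) := by
    intro r
    rw [← theta3_zero, theta3, zero_div]
  simp only [zero_div, e] at h
  have hr' : (Real.sqrt r : ℂ) ≠ 0 := by exact_mod_cast (Real.sqrt_pos.2 hr).ne'
  have h2 := congrArg (fun x => x ^ 2) h
  simp only [mul_pow, div_pow, sqrt_cpow_half_sq r] at h2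
  norm_num at h2
  field_simp at h2
  rw [mul_comm]
  simpa only [one_div] using (by exact_mod_cast h2.symm :
    thetaThree (quarterNome (1 / r)) ^ 2 = thetaThree (quarterNome r) ^ 2 * Real.sqrt r)

/-- The functional equation at the half period `1/2`, whose value is `ϑ₄`; the transformation sends
it to half of the other period, where the value is `ϑ₂` up to an exponential factor. -/
lemma thetaTwo_quarterNome_inv {r : ℝ} (hr : 0 < r) :
    thetaTwo (quarterNome r⁻¹) ^ 2 = Real.sqrt r * thetaFour (quarterNome r) ^ 2 := by
  have hpi : (Real.pi : ℂ) ≠ 0 := by exact_mod_cast Real.pi_ne_zero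
  have hr' : (Real.sqrt r : ℂ) ≠ 0 := by exact_mod_cast (Real.sqrt_pos.2 hr).ne'
  have ht : nomeTau r ≠ 0 := mul_ne_zero Complex.I_ne_zero hr'
  have hinv := neg_one_div_nomeTau hr
  have h := jacobiTheta₂_functional_equation (1 / 2) (nomeTau r)
  have e4 : jacobiTheta₂ (1 / 2) (nomeTau r) = thetaFour (quarterNome r) := by
    rw [← theta3_pi_div_two, theta3]
    congr 1
    field_simp
  have e2 : Complex.exp (-Real.pi * Complex.I * (1 / 2) ^ 2 / nomeTau r) *
      jacobiTheta₂ (1 / 2 / nomeTau r) (-1 / nomeTau r) = thetaTwo (quarterNome r⁻¹) := by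
    rw [← theta2_zero, theta2, ← jacobiTheta₂_neg_left, ← hinv]
    congr 2
    · field_simp; ring
    · field_simp; ring
  rw [mul_assoc, e2, e4] at h
  have h2 := congrArg (fun x => x ^ 2) h
  simp only [mul_pow, div_pow, sqrt_cpow_half_sq r] at h2
  field_simp at h2
  norm_num at h2
  rw [mul_comm]
  exact_mod_cast h2.symm

/-- The alternating series does not show that `ϑ₄ ≠ 0`, but the transformation turns it into `ϑ₂`, a
sum of positive terms. -/
lemma thetaFour_sq_pos {s : ℝ} (h0 : 0 < s) (h1 : s < 1) : 0 < thetaFour s ^ 2 := by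
  have hl := Real.log_neg h0 h1
  have hpi := Real.pi_pos
  -- Chosen so that `s = exp (-π t / 4)`, the quarter nome of `r = t²`.
  set t := -4 * Real.log s / Real.pi with ht
  have ht0 : 0 < t := div_pos (by linarith) hpi
  have hs : s = quarterNome (t ^ 2) := by
    rw [quarterNome, Real.sqrt_sq ht0.le, ht]
    field_simp
    rw [Real.exp_log h0]
  have hr : 0 < t ^ 2 := by positivity
  have h := thetaTwo_quarterNome_inv hr
  have hpos : 0 < thetaTwo (quarterNome (t ^ 2)⁻¹) ^ 2 :=
    pow_pos (thetaTwo_pos (quarterNome_pos _) (quarterNome_lt_one (inv_pos.2 hr))) 2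
  rw [h, ← hs] at hpos
  exact pos_of_mul_pos_right hpos (Real.sqrt_nonneg _)

/-! ### The singular modulus and `K` in terms of theta constants. -/

/-- The elliptic modulus `ϑ₂ ^ 2 / ϑ₃ ^ 2`. -/
noncomputable def thetaModulus (s : ℝ) : ℝ := thetaTwo s ^ 2 / thetaThree s ^ 2

lemma thetaModulus_pos {s : ℝ} (h0 : 0 < s) (h1 : s < 1) : 0 < thetaModulus s :=
  div_pos (pow_pos (thetaTwo_pos h0 h1) 2) (pow_pos (thetaThree_pos h0 h1) 2)

lemma one_sub_thetaModulus_sq {s : ℝ} (h0 : 0 < s) (h1 : s < 1) :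
    1 - thetaModulus s ^ 2 = (thetaFour s ^ 2 / thetaThree s ^ 2) ^ 2 := by
  have h3 := (thetaThree_pos h0 h1).ne'
  have h := thetaThree_pow_four h0 h1
  rw [thetaModulus]
  field_simp
  linear_combination h

lemma thetaModulus_lt_one {s : ℝ} (h0 : 0 < s) (h1 : s < 1) : thetaModulus s < 1 := by
  have h := one_sub_thetaModulus_sq h0 h1
  have h4 : 0 < thetaFour s ^ 2 / thetaThree s ^ 2 :=
    div_pos (thetaFour_sq_pos h0 h1) (pow_pos (thetaThree_pos h0 h1) 2)
  have : thetaModulus s ^ 2 < 1 := by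
    have := pow_pos h4 2
    linarith
  exact (sq_lt_one_iff₀ (thetaModulus_pos h0 h1).le).1 this

/-- The passage from `s²` to `s` acts on the modulus exactly as Landen's transformation acts on the
argument of `hypF`. -/
lemma thetaModulus_sq_landen {s : ℝ} (h0 : 0 < s) (h1 : s < 1) :
    thetaModulus s ^ 2 = 4 * thetaModulus (s ^ 2) / (1 + thetaModulus (s ^ 2)) ^ 2 := by
  have g0 : 0 < s ^ 2 := by positivity
  have g1 : s ^ 2 < 1 := pow_lt_one₀ h0.le h1 two_ne_zero
  have p := thetaThree_pos g0 g1
  rw [thetaModulus, thetaModulus, thetaThree_sq h0 h1, thetaTwo_sq h0 h1]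
  field_simp
  ring

lemma tendsto_thetaModulus : Tendsto thetaModulus (𝓝[>] 0) (𝓝 0) := by
  have hid : Tendsto (fun s : ℝ => s) (𝓝[>] 0) (𝓝 0) := nhdsWithin_le_nhds
  have h := ((tendsto_thetaTwo_div.mul hid).pow 2).div (tendsto_thetaThree.pow 2) (by norm_num)
  norm_num at h
  refine h.congr' ?_
  filter_upwards [self_mem_nhdsWithin] with s hs
  have : s ≠ 0 := (Set.mem_Ioi.1 hs).ne'
  simp only [Pi.div_apply, thetaModulus]
  field_simp

/-- Under `s² ↦ s` both `hypF` and `ϑ₃²` gain the factor `1 + thetaModulus (s ^ 2)`, so their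
quotient is invariant; its limit at zero is `1`, because `1 ≤ hypF x ≤ 1 / (1 - x)`. -/
lemma hypF_thetaModulus_sq {s : ℝ} (h0 : 0 < s) (h1 : s < 1) :
    hypF (thetaModulus s ^ 2) = thetaThree s ^ 2 := by
  have hlim : Tendsto (fun s => hypF (thetaModulus s ^ 2) / thetaThree s ^ 2) (𝓝[>] 0) (𝓝 1) := by
    have hm : Tendsto (fun s => thetaModulus s ^ 2) (𝓝[>] 0) (𝓝 0) := by
      simpa using tendsto_thetaModulus.pow 2
    have hF : Tendsto (fun s => hypF (thetaModulus s ^ 2)) (𝓝[>] 0) (𝓝 1) := by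
      have hu : Tendsto (fun s => (1 - thetaModulus s ^ 2)⁻¹) (𝓝[>] 0) (𝓝 1) := by
        simpa using (tendsto_const_nhds.sub hm).inv₀ (by norm_num : (1 : ℝ) - 0 ≠ 0)
      refine tendsto_of_tendsto_of_tendsto_of_le_of_le' tendsto_const_nhds hu ?_ ?_ <;>
      · filter_upwards [eventually_mem_Ioo_zero_half] with s hs
        have hs1 : s < 1 := by linarith [hs.2]
        have hlt := pow_lt_one₀ (thetaModulus_pos hs.1 hs1).le (thetaModulus_lt_one hs.1 hs1)
          two_ne_zero
        first
        | exact one_le_hypF (sq_nonneg _) hlt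
        | exact hypF_le (sq_nonneg _) hlt
    have h := hF.div (tendsto_thetaThree.pow 2) (by norm_num)
    rwa [one_pow, div_one] at h
  have hinv : ∀ s, 0 < s → s < 1 → hypF (thetaModulus (s ^ 2) ^ 2) / thetaThree (s ^ 2) ^ 2 =
      hypF (thetaModulus s ^ 2) / thetaThree s ^ 2 := by
    intro s h0 h1
    have g0 : 0 < s ^ 2 := by positivity
    have g1 : s ^ 2 < 1 := pow_lt_one₀ h0.le h1 two_ne_zero
    have p := thetaThree_pos g0 g1
    have hm := thetaModulus_pos g0 g1
    have h3 : thetaThree s ^ 2 = thetaThree (s ^ 2) ^ 2 * (1 + thetaModulus (s ^ 2)) := by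
      rw [thetaThree_sq h0 h1, thetaModulus]
      field_simp
    rw [thetaModulus_sq_landen h0 h1, hypF_landen hm.le (thetaModulus_lt_one g0 g1), h3]
    field_simp
  have := eq_of_tendsto_of_invariant hlim hinv h0 h1
  rwa [div_eq_one_iff_eq (pow_pos (thetaThree_pos h0 h1) 2).ne'] at this

lemma ellipticK_thetaModulus {s : ℝ} (h0 : 0 < s) (h1 : s < 1) :
    ellipticK (thetaModulus s) = Real.pi / 2 * thetaThree s ^ 2 := by
  rw [ellipticK_eq, hypF_thetaModulus_sq h0 h1]

lemma ellipticK_pos {x : ℝ} (h0 : 0 ≤ x) (h1 : x < 1) : 0 < ellipticK x := by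
  rw [ellipticK_eq]
  have := one_le_hypF (sq_nonneg x) (pow_lt_one₀ h0 h1 two_ne_zero)
  have := Real.pi_pos
  positivity

lemma ellipticK_strictMonoOn : StrictMonoOn ellipticK (Set.Ico 0 1) := by
  intro x hx y hy hxy
  rw [ellipticK_eq, ellipticK_eq]
  have h : hypF (x ^ 2) < hypF (y ^ 2) :=
    hypF_strictMonoOn ⟨sq_nonneg _, pow_lt_one₀ hx.1 hx.2 two_ne_zero⟩
      ⟨sq_nonneg _, pow_lt_one₀ hy.1 hy.2 two_ne_zero⟩ (pow_lt_pow_left₀ hxy hx.1 two_ne_zero)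
  have := Real.pi_pos
  exact mul_lt_mul_of_pos_left h (by positivity)

lemma isSingularModulus_thetaModulus {r : ℝ} (hr : 0 < r) :
    IsSingularModulus r (thetaModulus (quarterNome r)) := by
  have h0 := quarterNome_pos r
  have h1 := quarterNome_lt_one hr
  have g0 := quarterNome_pos r⁻¹
  have g1 := quarterNome_lt_one (inv_pos.2 hr)
  refine ⟨thetaModulus_pos h0 h1, thetaModulus_lt_one h0 h1, ?_⟩
  have hs := Real.sqrt_pos.2 hr
  have hp3 := thetaThree_pos h0 h1
  -- By Jacobi's identity the complementary modulus is `ϑ₄²/ϑ₃²`, which `r ↦ 1/r` identifies with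
  -- the modulus for `1/r`.
  have hk : Real.sqrt (1 - thetaModulus (quarterNome r) ^ 2) =
      thetaModulus (quarterNome r⁻¹) := by
    rw [one_sub_thetaModulus_sq h0 h1, Real.sqrt_sq (by positivity), thetaModulus,
      thetaTwo_quarterNome_inv hr, thetaThree_quarterNome_inv hr]
    field_simp
  rw [hk, ellipticK_thetaModulus h0 h1, ellipticK_thetaModulus g0 g1,
    thetaThree_quarterNome_inv hr]
  have := Real.pi_pos
  field_simp

/-- `K` increases strictly, so the ratio `K(√(1 - k²)) / K(k)` decreases strictly in `k`; applied in
both directions this gives uniqueness. -/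
lemma IsSingularModulus.le {r k l : ℝ} (hk : IsSingularModulus r k)
    (hl : IsSingularModulus r l) : l ≤ k := by
  by_contra! h
  have hk0 := hk.pos
  have hl0 := hl.pos
  have hmono := ellipticK_strictMonoOn ⟨hk0.le, hk.lt_one⟩ ⟨hl0.le, hl.lt_one⟩ h
  have hlt : Real.sqrt (1 - l ^ 2) < Real.sqrt (1 - k ^ 2) := by
    refine Real.sqrt_lt_sqrt ?_ ?_
    · have := pow_le_one₀ (n := 2) hl0.le hl.lt_one.le
      linarith
    · have := pow_lt_pow_left₀ h hk0.le two_ne_zero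
      linarith
  have hk1 : Real.sqrt (1 - k ^ 2) < 1 := by
    rw [Real.sqrt_lt' one_pos]
    have := pow_pos hk0 2
    linarith
  have hmono' := ellipticK_strictMonoOn ⟨Real.sqrt_nonneg _, hlt.trans hk1⟩
    ⟨Real.sqrt_nonneg _, hk1⟩ hlt
  have hpos := ellipticK_pos hk0.le hk.lt_one
  have h1 := hk.ratio.trans hl.ratio.symm
  have h2 := div_lt_div₀ hmono' hmono.le (ellipticK_pos (Real.sqrt_nonneg _) hk1).le hpos
  exact h2.ne h1.symm

lemma IsSingularModulus.eq_thetaModulus {r k : ℝ} (hr : 0 < r) (hk : IsSingularModulus r k) :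
    k = thetaModulus (quarterNome r) :=
  le_antisymm ((isSingularModulus_thetaModulus hr).le hk) (hk.le (isSingularModulus_thetaModulus hr))

lemma IsSingularModulus.ellipticK_mul {r k : ℝ} (hr : 0 < r) (hk : IsSingularModulus r k) :
    ellipticK k * k = Real.pi / 2 * thetaTwo (quarterNome r) ^ 2 := by
  have h0 := quarterNome_pos r
  have h1 := quarterNome_lt_one hr
  have := thetaThree_pos h0 h1
  rw [hk.eq_thetaModulus hr, ellipticK_thetaModulus h0 h1, thetaModulus]
  field_simp

/-! ### The bilateral Lambert series and its product with `ϑ₃`. -/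

lemma summable_zpow_quadratic {s : ℝ} (h0 : 0 < s) (h1 : s < 1) (a b : ℤ) :
    Summable fun n : ℤ => s ^ (4 * n ^ 2 + 2 * a * n + b) := by
  have hs : (s : ℂ) ≠ 0 := by exact_mod_cast h0.ne'
  have h := (summable_thetaEven h0 h1 (zpow_ne_zero a hs)).mul_right ((s : ℂ) ^ b)
  rw [← Complex.summable_ofReal]
  convert! h using 2 with n
  rw [← zpow_mul, ← zpow_add₀ hs, ← zpow_add₀ hs]
  push_cast
  congr 1; ring

/-- The factor `1 / (1 - q ^ (2 n + 1))` of the Lambert series below. -/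
noncomputable def lambertFactor (q : ℝ) (n : ℤ) : ℝ := (1 - q ^ (2 * n + 1))⁻¹

lemma lambertFactor_neg_succ {q : ℝ} (h0 : 0 < q) (h1 : q < 1) (n : ℕ) :
    lambertFactor q (-(n + 1)) = -(q ^ (2 * n + 1) * lambertFactor q n) := by
  have hq : q ^ (2 * n + 1) < 1 := pow_lt_one₀ h0.le h1 (by omega)
  have hq0 : 0 < q ^ (2 * n + 1) := by positivity
  have e1 : q ^ (2 * (-((n : ℤ) + 1)) + 1) = (q ^ (2 * n + 1))⁻¹ := by
    rw [← zpow_natCast, ← zpow_neg]; congr 1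
  have e2 : q ^ (2 * (n : ℤ) + 1) = q ^ (2 * n + 1) := by
    rw [← zpow_natCast]; congr 1
  rw [lambertFactor, lambertFactor, e1, e2]
  generalize q ^ (2 * n + 1) = x at *
  have h2 : 1 - x ≠ 0 := by linarith
  have h3 : 1 - x⁻¹ = -((1 - x) / x) := by field_simp; ring
  rw [h3, inv_neg, inv_div]
  field_simp

lemma abs_lambertFactor_natCast_le {q : ℝ} (h0 : 0 < q) (h1 : q < 1) (n : ℕ) :
    |lambertFactor q n| ≤ (1 - q)⁻¹ := by
  have hq : q ^ (2 * n + 1) ≤ q := pow_le_of_le_one h0.le h1.le (by omega)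
  have e2 : q ^ (2 * (n : ℤ) + 1) = q ^ (2 * n + 1) := by
    rw [← zpow_natCast]; congr 1
  rw [lambertFactor, e2, abs_of_pos (inv_pos.2 (by linarith))]
  exact inv_anti₀ (by linarith) (by linarith)

lemma abs_lambertFactor_le {q : ℝ} (h0 : 0 < q) (h1 : q < 1) (n : ℤ) :
    |lambertFactor q n| ≤ (1 - q)⁻¹ := by
  rcases lt_or_ge n 0 with hn | hn
  · obtain ⟨m, rfl⟩ : ∃ m : ℕ, n = -((m : ℤ) + 1) := ⟨(-n - 1).toNat, by omega⟩
    rw [lambertFactor_neg_succ h0 h1, abs_neg, abs_mul, abs_of_pos (by positivity)]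
    exact (mul_le_of_le_one_left (abs_nonneg _) (pow_le_one₀ h0.le h1.le)).trans
      (abs_lambertFactor_natCast_le h0 h1 m)
  · lift n to ℕ using hn
    exact abs_lambertFactor_natCast_le h0 h1 n

lemma lambertFactor_mul {q : ℝ} (h0 : 0 < q) (h1 : q < 1) (n : ℤ) :
    (1 - q ^ (2 * n + 1)) * lambertFactor q n = 1 := by
  refine mul_inv_cancel₀ fun h => ?_
  have : q ^ (2 * n + 1) = q ^ (0 : ℤ) := by rw [zpow_zero]; linarith
  have := zpow_right_injective₀ h0 h1.ne this
  omega

/-- The Lambert series `∑ (-1) ^ n w ^ (2 n + 1) / (1 - q ^ (2 n + 1))`. -/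
noncomputable def oddLambert (q : ℝ) (w : ℂ) : ℂ :=
  ∑' n : ℕ, (-1) ^ n * w ^ (2 * n + 1) / (1 - (q : ℂ) ^ (2 * n + 1))

lemma lambertFactor_natCast (q : ℝ) (n : ℕ) :
    (lambertFactor q n : ℂ) = (1 - (q : ℂ) ^ (2 * n + 1))⁻¹ := by
  have e2 : q ^ (2 * (n : ℤ) + 1) = q ^ (2 * n + 1) := by
    rw [← zpow_natCast]; congr 1
  rw [lambertFactor, e2]; push_cast; rfl

lemma norm_oddLambert_term_le {q : ℝ} (h0 : 0 < q) (h1 : q < 1) (w : ℂ) (n : ℕ) :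
    ‖(-1) ^ n * w ^ (2 * n + 1) / (1 - (q : ℂ) ^ (2 * n + 1))‖ ≤
      ‖w‖ ^ (2 * n + 1) * (1 - q)⁻¹ := by
  rw [div_eq_mul_inv, ← lambertFactor_natCast, norm_mul, norm_mul, norm_pow, norm_pow, norm_neg,
    norm_one, one_pow, one_mul, Complex.norm_real]
  exact mul_le_mul_of_nonneg_left (abs_lambertFactor_natCast_le h0 h1 n) (by positivity)

lemma summable_pow_odd {x : ℝ} (h0 : 0 ≤ x) (h1 : x < 1) :
    Summable fun n : ℕ => x ^ (2 * n + 1) := by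
  simp only [pow_succ, pow_mul]
  exact (summable_geometric_of_lt_one (sq_nonneg x) (pow_lt_one₀ h0 h1 two_ne_zero)).mul_right x

lemma summable_oddLambert {q : ℝ} (h0 : 0 < q) (h1 : q < 1) {w : ℂ} (hw : ‖w‖ < 1) :
    Summable fun n : ℕ => (-1) ^ n * w ^ (2 * n + 1) / (1 - (q : ℂ) ^ (2 * n + 1)) :=
  ((summable_pow_odd (norm_nonneg w) hw).mul_right _).of_norm_bounded
    (norm_oddLambert_term_le h0 h1 w)

/-- The indices `n ≥ 0` give the series in `s² w`. Under `n ↦ -n - 1` the sign of `(-1)^n` and that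
of `lambertFactor` cancel, and the negative indices give the series in `s² / w`. -/
lemma hasSum_bilateral_oddLambert {s : ℝ} (h0 : 0 < s) (h1 : s < 1) {w : ℂ} (hw : w ≠ 0)
    (hw1 : ‖(s : ℂ) ^ 2 * w‖ < 1) (hw2 : ‖(s : ℂ) ^ 2 / w‖ < 1) :
    HasSum (fun n : ℤ => (-1 : ℂ) ^ n * (s : ℂ) ^ (2 * (2 * n + 1)) * w ^ (2 * n + 1) *
      lambertFactor (s ^ 4) n)
      (oddLambert (s ^ 4) (s ^ 2 * w) + oddLambert (s ^ 4) (s ^ 2 / w)) := by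
  have hs : (s : ℂ) ≠ 0 := by exact_mod_cast h0.ne'
  have q0 : 0 < s ^ 4 := by positivity
  have q1 : s ^ 4 < 1 := pow_lt_one₀ h0.le h1 (by norm_num)
  refine HasSum.of_nat_of_neg_add_one ?_ ?_
  · convert! (summable_oddLambert q0 q1 hw1).hasSum using 2 with n
    rw [lambertFactor_natCast, div_eq_mul_inv, mul_pow, ← pow_mul, zpow_natCast,
      ← zpow_natCast w, ← zpow_natCast (s : ℂ)]
    push_cast
    ring
  · convert! (summable_oddLambert q0 q1 hw2).hasSum using 2 with n
    rw [lambertFactor_neg_succ q0 q1, div_eq_mul_inv _ (1 - _), Complex.ofReal_neg,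
      Complex.ofReal_mul, lambertFactor_natCast, div_pow]
    have e1 : (-1 : ℂ) ^ (-((n : ℤ) + 1)) = -(-1) ^ n := by
      rw [zpow_neg, zpow_add₀ (by norm_num), zpow_natCast, zpow_one, mul_inv, ← inv_pow]
      norm_num
    have e2 : w ^ (2 * (-((n : ℤ) + 1)) + 1) = (w ^ (2 * n + 1))⁻¹ := by
      rw [← zpow_natCast, ← zpow_neg]; congr 1
    have e3 : (s : ℂ) ^ (2 * (2 * (-((n : ℤ) + 1)) + 1)) = (((s : ℂ) ^ 2) ^ (2 * n + 1))⁻¹ := by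
      rw [← pow_mul, ← zpow_natCast, ← zpow_neg]; congr 1
    have e4 : (((s ^ 4) ^ (2 * n + 1) : ℝ) : ℂ) =
        ((s : ℂ) ^ 2) ^ (2 * n + 1) * ((s : ℂ) ^ 2) ^ (2 * n + 1) := by
      rw [← mul_pow]; push_cast; ring
    rw [e1, e2, e3, e4]
    field_simp

/-- The constant of proportionality `∑ (-1) ^ n s ^ (2 n + 1) ^ 2 / (1 - s ^ (4 (2 n + 1)))`
between `ϑ₂` and the product of `ϑ₃` and a bilateral Lambert series. -/
noncomputable def lambertConst (s : ℝ) : ℝ :=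
  ∑' n : ℤ, (-1) ^ n * s ^ ((2 * n + 1) ^ 2) * lambertFactor (s ^ 4) n

/-- The coefficient of `w ^ (2 N + 1)` in the product of `ϑ₃` and the bilateral Lambert series. -/
noncomputable def lambertCoeff (s : ℝ) (N : ℤ) : ℝ :=
  ∑' n : ℤ, (-1) ^ n * s ^ (4 * (N - n) ^ 2 + 2 * (2 * n + 1)) * lambertFactor (s ^ 4) n

lemma summable_lambertCoeff {s : ℝ} (h0 : 0 < s) (h1 : s < 1) (N : ℤ) :
    Summable fun n : ℤ =>
      (-1) ^ n * s ^ (4 * (N - n) ^ 2 + 2 * (2 * n + 1)) * lambertFactor (s ^ 4) n := by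
  refine ((summable_zpow_quadratic h0 h1 (2 - 4 * N) (4 * N ^ 2 + 2)).mul_right
    (1 - s ^ 4)⁻¹).of_norm_bounded fun n => ?_
  rw [Real.norm_eq_abs, mul_assoc, abs_neg_one_zpow_mul, abs_mul, abs_of_pos (zpow_pos h0 _),
    show 4 * (N - n) ^ 2 + 2 * (2 * n + 1) = 4 * n ^ 2 + 2 * (2 - 4 * N) * n + (4 * N ^ 2 + 2) by
      ring]
  exact mul_le_mul_of_nonneg_left
    (abs_lambertFactor_le (by positivity) (pow_lt_one₀ h0.le h1 (by norm_num)) n)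
    (zpow_pos h0 _).le

/-- The reflection `n ↦ 2N + 1 - n` preserves the exponent and reverses the sign. -/
lemma tsum_neg_one_zpow_mul_eq_zero (s : ℝ) (N : ℤ) :
    ∑' n : ℤ, (-1) ^ n * s ^ (4 * (N - n) ^ 2 + 8 * N - 4 * n + 6) = 0 := by
  have h := ((Equiv.subLeft (2 * N + 1)).tsum_eq
    (fun n : ℤ => (-1) ^ n * s ^ (4 * (N - n) ^ 2 + 8 * N - 4 * n + 6))).symm
  have h2 : ∀ n : ℤ, (-1) ^ (Equiv.subLeft (2 * N + 1) n) *
      s ^ (4 * (N - Equiv.subLeft (2 * N + 1) n) ^ 2 + 8 * N -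
        4 * (Equiv.subLeft (2 * N + 1) n) + 6) =
      -((-1) ^ n * s ^ (4 * (N - n) ^ 2 + 8 * N - 4 * n + 6)) := by
    intro n
    rw [Equiv.subLeft_apply, zpow_sub₀ (by norm_num), Odd.neg_one_zpow ⟨N, rfl⟩,
      show 4 * (N - (2 * N + 1 - n)) ^ 2 + 8 * N - 4 * (2 * N + 1 - n) + 6 =
        4 * (N - n) ^ 2 + 8 * N - 4 * n + 6 by ring, neg_div, one_div, ← zpow_neg, zpow_neg,
      ← inv_zpow]
    norm_num
  simp only [h2, tsum_neg] at h
  linarith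

/-- In the difference of the two sides the numerators combine to a multiple of `1 - s^(4(2n+1))`,
which cancels the Lambert denominator; the remaining alternating sum vanishes. The factor is
`s^((2N+3)² - (2N+1)²)`, the ratio of successive coefficients of `ϑ₂`. -/
lemma lambertCoeff_succ {s : ℝ} (h0 : 0 < s) (h1 : s < 1) (N : ℤ) :
    lambertCoeff s (N + 1) = s ^ (8 * N + 8) * lambertCoeff s N := by
  have q0 : 0 < s ^ 4 := by positivity
  have q1 : s ^ 4 < 1 := pow_lt_one₀ h0.le h1 (by norm_num)
  rw [← sub_eq_zero, lambertCoeff, lambertCoeff, ← tsum_mul_left,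
    ← (summable_lambertCoeff h0 h1 (N + 1)).tsum_sub ((summable_lambertCoeff h0 h1 N).mul_left _),
    ← tsum_neg_one_zpow_mul_eq_zero s N]
  refine tsum_congr fun n => ?_
  have h := lambertFactor_mul q0 q1 n
  have e : (s ^ 4) ^ (2 * n + 1) = s ^ (4 * (2 * n + 1)) := by rw [zpow_mul]; norm_cast
  rw [e] at h
  have e1 : s ^ (8 * N + 8) * s ^ (4 * (N - n) ^ 2 + 2 * (2 * n + 1)) =
      s ^ (4 * (N - n) ^ 2 + 8 * N - 4 * n + 6) * s ^ (4 * (2 * n + 1)) := by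
    rw [← zpow_add₀ h0.ne', ← zpow_add₀ h0.ne']; congr 1; ring
  have e2 : 4 * (N + 1 - n) ^ 2 + 2 * (2 * n + 1) = 4 * (N - n) ^ 2 + 8 * N - 4 * n + 6 := by ring
  rw [e2]
  linear_combination (-1) ^ n * s ^ (4 * (N - n) ^ 2 + 8 * N - 4 * n + 6) * h -
    (-1) ^ n * lambertFactor (s ^ 4) n * e1

lemma lambertCoeff_eq {s : ℝ} (h0 : 0 < s) (h1 : s < 1) (N : ℤ) :
    lambertCoeff s N = lambertConst s * s ^ ((2 * N + 1) ^ 2) := by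
  have hz : lambertCoeff s 0 = lambertConst s * s := by
    rw [lambertCoeff, lambertConst, ← tsum_mul_right]
    refine tsum_congr fun n => ?_
    have : s ^ (4 * (0 - n) ^ 2 + 2 * (2 * n + 1)) = s ^ ((2 * n + 1) ^ 2) * s := by
      rw [← zpow_add_one₀ h0.ne']; congr 1; ring
    rw [this]; ring
  have hstep : ∀ M : ℤ, s ^ ((2 * (M + 1) + 1) ^ 2) = s ^ (8 * M + 8) * s ^ ((2 * M + 1) ^ 2) := by
    intro M
    rw [← zpow_add₀ h0.ne']; congr 1; ring
  induction N using Int.induction_on with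
  | zero => simpa using hz
  | succ n ih =>
    rw [lambertCoeff_succ h0 h1, ih, hstep]; ring
  | pred n ih =>
    have h := lambertCoeff_succ h0 h1 (-(n : ℤ) - 1)
    have h' := hstep (-(n : ℤ) - 1)
    rw [sub_add_cancel] at h h'
    rw [ih, h'] at h
    have hp : s ^ (8 * (-(n : ℤ) - 1) + 8) ≠ 0 := (zpow_pos h0 _).ne'
    exact mul_left_cancel₀ hp (by rw [← h]; ring)

/-- The product of `ϑ₃` and the bilateral Lambert series is a multiple of `ϑ₂`. -/
lemma thetaEven_mul_oddLambert {s : ℝ} (h0 : 0 < s) (h1 : s < 1) {w : ℂ} (hw : w ≠ 0)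
    (hw1 : ‖(s : ℂ) ^ 2 * w‖ < 1) (hw2 : ‖(s : ℂ) ^ 2 / w‖ < 1) :
    thetaEven s w * (oddLambert (s ^ 4) (s ^ 2 * w) + oddLambert (s ^ 4) (s ^ 2 / w)) =
      lambertConst s * thetaOdd s w := by
  have hs : (s : ℂ) ≠ 0 := by exact_mod_cast h0.ne'
  have h3 := (summable_thetaEven h0 h1 hw).norm
  have hL := hasSum_bilateral_oddLambert h0 h1 hw hw1 hw2
  have hLn := hL.summable.norm
  -- The shear `(N, n) ↦ (N - n, n)` collects the terms with the same power `w^(2N+1)`.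
  let e : ℤ × ℤ ≃ ℤ × ℤ :=
    { toFun := fun p => (p.1 - p.2, p.2)
      invFun := fun p => (p.1 + p.2, p.2)
      left_inv := fun p => by simp
      right_inv := fun p => by simp }
  have hprod := e.summable_iff.2 (summable_mul_of_summable_norm h3 hLn)
  simp only [Function.comp_def] at hprod
  rw [← hL.tsum_eq, thetaEven, tsum_mul_tsum_of_summable_norm h3 hLn, ← e.tsum_eq,
    hprod.tsum_prod, thetaOdd, ← tsum_mul_left]
  refine tsum_congr fun N => ?_
  have hc : ((lambertCoeff s N : ℝ) : ℂ) = lambertConst s * (s : ℂ) ^ ((2 * N + 1) ^ 2) := by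
    rw [lambertCoeff_eq h0 h1]; push_cast; rfl
  rw [← mul_assoc, ← hc, lambertCoeff, Complex.ofReal_tsum, ← tsum_mul_right]
  refine tsum_congr fun n => ?_
  simp only [e, Equiv.coe_fn_mk]
  have e1 : w ^ (2 * N + 1) = w ^ (2 * (N - n)) * w ^ (2 * n + 1) := by
    rw [← zpow_add₀ hw]; congr 1; ring
  push_cast
  rw [e1, zpow_add₀ hs]
  ring

/-- The reflection `n ↦ -1 - n` matches the exponents. At `w = s` both theta functions therefore
cancel from the product formula, which isolates `lambertConst`. -/
lemma thetaEven_self_eq_thetaOdd_self {s : ℝ} (h0 : 0 < s) :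
    thetaEven s s = thetaOdd s s := by
  have hs : (s : ℂ) ≠ 0 := by exact_mod_cast h0.ne'
  rw [thetaEven, thetaOdd, ← (Equiv.subLeft (-1 : ℤ)).tsum_eq]
  refine tsum_congr fun n => ?_
  rw [Equiv.subLeft_apply, ← zpow_add₀ hs, ← zpow_add₀ hs]
  congr 1; ring

lemma thetaEven_self_ne_zero {s : ℝ} (h0 : 0 < s) (h1 : s < 1) : thetaEven s s ≠ 0 := by
  have h := summable_zpow_quadratic h0 h1 1 0
  have hpos : 0 < ∑' n : ℤ, s ^ (4 * n ^ 2 + 2 * 1 * n + 0) :=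
    h.tsum_pos (fun _ => (zpow_pos h0 _).le) 0 (zpow_pos h0 _)
  have hs : (s : ℂ) ≠ 0 := by exact_mod_cast h0.ne'
  have he : thetaEven s s = ((∑' n : ℤ, s ^ (4 * n ^ 2 + 2 * 1 * n + 0) : ℝ) : ℂ) := by
    rw [thetaEven, Complex.ofReal_tsum]
    refine tsum_congr fun n => ?_
    rw [← zpow_add₀ hs]; push_cast; congr 1; ring
  rw [he]
  exact_mod_cast hpos.ne'

/-- Termwise this is `(x³ + x) / (1 - x⁴) = x / (1 - x²)` with `x = s^(2n+1)`. -/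
lemma oddLambert_add_oddLambert_cube {s : ℝ} (h0 : 0 < s) (h1 : s < 1) :
    oddLambert (s ^ 4) (s ^ 3) + oddLambert (s ^ 4) s = oddLambert (s ^ 2) s := by
  have q0 : 0 < s ^ 4 := by positivity
  have q1 : s ^ 4 < 1 := pow_lt_one₀ h0.le h1 (by norm_num)
  have hw : ‖(s : ℂ)‖ < 1 := by rwa [Complex.norm_real, Real.norm_of_nonneg h0.le]
  have hw3 : ‖(s : ℂ) ^ 3‖ < 1 := by
    rw [norm_pow]; exact pow_lt_one₀ (norm_nonneg _) hw (by norm_num)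
  rw [oddLambert, oddLambert, oddLambert,
    ← (summable_oddLambert q0 q1 hw3).tsum_add (summable_oddLambert q0 q1 hw)]
  refine tsum_congr fun n => ?_
  have hx1 : s ^ (2 * n + 1) < 1 := pow_lt_one₀ h0.le h1 (by omega)
  have hx0 : 0 < s ^ (2 * n + 1) := by positivity
  push_cast
  rw [← pow_mul, ← pow_mul, ← pow_mul, mul_comm 3, mul_comm 4, mul_comm 2 (2 * n + 1), pow_mul _ _ 3,
    pow_mul _ _ 4, pow_mul _ (2 * n + 1) 2]
  norm_cast
  generalize s ^ (2 * n + 1) = x at *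
  have d1 : 1 - x ^ 2 ≠ 0 := by nlinarith
  have d2 : 1 - x ^ 4 ≠ 0 := by
    have := pow_lt_one₀ hx0.le hx1 (n := 4) (by norm_num)
    linarith
  rw [← Complex.ofReal_inj]
  push_cast
  have d1' : (1 : ℂ) - (x : ℂ) ^ 2 ≠ 0 := by exact_mod_cast d1
  have d2' : (1 : ℂ) - (x : ℂ) ^ 4 ≠ 0 := by exact_mod_cast d2
  field_simp
  ring

lemma oddLambert_eq_lambertConst {s : ℝ} (h0 : 0 < s) (h1 : s < 1) :
    oddLambert (s ^ 2) s = lambertConst s := by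
  have hs : (s : ℂ) ≠ 0 := by exact_mod_cast h0.ne'
  have hw : ‖(s : ℂ)‖ < 1 := by rwa [Complex.norm_real, Real.norm_of_nonneg h0.le]
  have e3 : (s : ℂ) ^ 2 * s = s ^ 3 := by ring
  have e1 : (s : ℂ) ^ 2 / s = s := by field_simp
  have h := thetaEven_mul_oddLambert h0 h1 hs
    (by rw [e3, norm_pow]; exact pow_lt_one₀ (norm_nonneg _) hw (by norm_num)) (by rwa [e1])
  rw [e3, e1, oddLambert_add_oddLambert_cube h0 h1, ← thetaEven_self_eq_thetaOdd_self h0,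
    mul_comm] at h
  exact mul_right_cancel₀ (thetaEven_self_ne_zero h0 h1) h

/-- The product formula at `w = 1`, where both Lambert series are `oddLambert (s ^ 4) (s ^ 2)`,
which is `lambertConst (s ^ 2)`. -/
lemma lambertConst_duplication {s : ℝ} (h0 : 0 < s) (h1 : s < 1) :
    2 * lambertConst (s ^ 2) * thetaThree s = lambertConst s * thetaTwo s := by
  have hw : ‖(s : ℂ)‖ < 1 := by rwa [Complex.norm_real, Real.norm_of_nonneg h0.le]
  have hw2 : ‖(s : ℂ) ^ 2‖ < 1 := by
    rw [norm_pow]; exact pow_lt_one₀ (norm_nonneg _) hw (by norm_num)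
  have h := thetaEven_mul_oddLambert h0 h1 one_ne_zero (by rwa [mul_one]) (by rwa [div_one])
  have h2 := oddLambert_eq_lambertConst (s := s ^ 2) (by positivity)
    (pow_lt_one₀ h0.le h1 two_ne_zero)
  rw [← pow_mul] at h2
  push_cast at h2
  rw [mul_one, div_one, h2, thetaEven_one, thetaOdd_one] at h
  rw [← Complex.ofReal_inj]
  push_cast
  rw [← h]; ring

lemma lambertConst_div {s : ℝ} (h0 : 0 < s) :
    lambertConst s / s =
      ∑' n : ℤ, (-1) ^ n * s ^ (4 * (n * (n + 1))) * lambertFactor (s ^ 4) n := by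
  rw [lambertConst, ← tsum_div_const]
  refine tsum_congr fun n => ?_
  rw [← zpow_odd_sq_div h0]; ring

lemma tendsto_lambertConst_div : Tendsto (fun s => lambertConst s / s) (𝓝[>] 0) (𝓝 1) := by
  have hq : Tendsto (fun s : ℝ => s ^ 4) (𝓝[>] 0) (𝓝 0) := by
    simpa using tendsto_zpow_nhdsGT_zero (k := 4) (by norm_num)
  have hinv : Tendsto (fun s : ℝ => (1 - s ^ 4)⁻¹) (𝓝[>] 0) (𝓝 1) := by
    simpa using (tendsto_const_nhds.sub hq).inv₀ (by norm_num : (1 : ℝ) - 0 ≠ 0)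
  have hq1 : ∀ s ∈ Set.Ioo (0 : ℝ) (1 / 2), s ^ 4 ≤ 1 / 2 := by
    intro s hs
    exact (pow_le_of_le_one hs.1.le (by linarith [hs.2]) (by norm_num)).trans hs.2.le
  have hbound : ∀ s ∈ Set.Ioo (0 : ℝ) (1 / 2), ∀ n : ℤ, |lambertFactor (s ^ 4) n| ≤ 2 := by
    intro s hs n
    have := hq1 s hs
    refine (abs_lambertFactor_le (pow_pos hs.1 4) (by linarith) n).trans ?_
    rw [inv_le_comm₀ (by linarith) (by norm_num)]
    linarith
  have hnorm : ∀ s ∈ Set.Ioo (0 : ℝ) (1 / 2), ∀ n : ℤ,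
      ‖(-1) ^ n * s ^ (4 * (n * (n + 1))) * lambertFactor (s ^ 4) n‖ ≤
        s ^ (4 * (n * (n + 1))) * 2 := by
    intro s hs n
    rw [Real.norm_eq_abs, mul_assoc, abs_neg_one_zpow_mul, abs_mul, abs_of_pos (zpow_pos hs.1 _)]
    exact mul_le_mul_of_nonneg_left (hbound s hs n) (zpow_pos hs.1 _).le
  have h := tendsto_tsum_of_dominated_convergence (𝓕 := 𝓝[>] (0 : ℝ))
    (f := fun (s : ℝ) (n : ℤ) => (-1) ^ n * s ^ (4 * (n * (n + 1))) * lambertFactor (s ^ 4) n)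
    (g := fun n => if n = 0 then (1 : ℝ) else 0)
    (summable_half_zpow.mul_right 2)
    (fun n => by
      by_cases hn : n = 0
      · simpa [hn, lambertFactor] using hinv
      rw [if_neg hn]
      by_cases hn' : n = -1
      -- At `n = -1` the power of `s` is `1`, as at `n = 0`, but the Lambert factor is `-q / (1 -
      -- q)` with `q = s⁴`, which tends to zero.
      · have : Tendsto (fun s : ℝ => s ^ 4 * (1 - s ^ 4)⁻¹) (𝓝[>] 0) (𝓝 0) := by
          simpa using hq.mul hinv
        refine this.congr' ?_
        filter_upwards [eventually_mem_Ioo_zero_half] with s hs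
        have := lambertFactor_neg_succ (pow_pos hs.1 4) (by linarith [hq1 s hs]) 0
        simp only [Nat.cast_zero, zero_add] at this
        rw [hn', this, lambertFactor]
        norm_num
      · have := int_mul_succ_pos hn hn'
        refine squeeze_zero_norm' (a := fun s : ℝ => s ^ (4 * (n * (n + 1))) * 2) ?_ ?_
        · filter_upwards [eventually_mem_Ioo_zero_half] with s hs using hnorm s hs n
        · simpa using (tendsto_zpow_nhdsGT_zero (k := 4 * (n * (n + 1)))
            (by positivity)).mul_const 2)
    (by
      filter_upwards [eventually_mem_Ioo_zero_half] with s hs n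
      have := int_mul_succ_nonneg n
      exact (hnorm s hs n).trans
        (mul_le_mul_of_nonneg_right (zpow_le_half_zpow hs.1 hs.2 (by positivity)) two_pos.le))
  rw [tsum_ite_eq] at h
  refine h.congr' ?_
  filter_upwards [self_mem_nhdsWithin] with s hs using (lambertConst_div hs).symm

/-- The duplication formulas for `lambertConst` and `ϑ₂` make the quotient of the two sides
invariant under `s ↦ s²`; its limit at zero is `1`. -/
lemma lambertConst_eq {s : ℝ} (h0 : 0 < s) (h1 : s < 1) :
    2 * lambertConst s = thetaTwo s * thetaThree s := by
  have hlim : Tendsto (fun s => 2 * lambertConst s / (thetaTwo s * thetaThree s)) (𝓝[>] 0)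
      (𝓝 1) := by
    have h := (tendsto_lambertConst_div.const_mul 2).div
      (tendsto_thetaTwo_div.mul tendsto_thetaThree) (by norm_num)
    norm_num at h
    refine h.congr' ?_
    filter_upwards [eventually_mem_Ioo_zero_half] with s hs
    have h1 := hs.1
    have := thetaTwo_pos hs.1 (by linarith [hs.2])
    have := thetaThree_pos hs.1 (by linarith [hs.2])
    simp only [Pi.div_apply]
    field_simp
  have hinv : ∀ s, 0 < s → s < 1 →
      2 * lambertConst (s ^ 2) / (thetaTwo (s ^ 2) * thetaThree (s ^ 2)) =
        2 * lambertConst s / (thetaTwo s * thetaThree s) := by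
    intro s h0 h1
    have g0 : 0 < s ^ 2 := by positivity
    have g1 : s ^ 2 < 1 := pow_lt_one₀ h0.le h1 two_ne_zero
    have := thetaTwo_pos h0 h1
    have := thetaThree_pos h0 h1
    have := thetaTwo_pos g0 g1
    have := thetaThree_pos g0 g1
    have h2 := thetaTwo_sq h0 h1
    have hd := lambertConst_duplication h0 h1
    rw [div_eq_div_iff (by positivity) (by positivity)]
    linear_combination thetaTwo s * hd + lambertConst s * h2
  have := eq_of_tendsto_of_invariant hlim hinv h0 h1
  have p2 := thetaTwo_pos h0 h1
  have p3 := thetaThree_pos h0 h1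
  rwa [div_eq_one_iff_eq (by positivity)] at this

/-! ### The Fourier series of `cd` and `cd₁` in the strip. -/

lemma halfNomeExp_eq (r k : ℝ) (u : ℂ) :
    halfNomeExp r k u = (quarterNome r : ℂ) ^ 2 * Complex.exp (Complex.I * thetaArg k u) := by
  rw [halfNomeExp, thetaArg, nome, ← Real.exp_mul, quarterNome, ← Complex.ofReal_pow,
    ← Real.exp_nat_mul]
  congr 3
  · push_cast; ring
  · ring

lemma thetaArg_neg (k : ℝ) (u : ℂ) : thetaArg k (-u) = -thetaArg k u := by
  rw [thetaArg, thetaArg]; ring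

lemma halfNomeExp_neg (r k : ℝ) (u : ℂ) :
    halfNomeExp r k (-u) = (quarterNome r : ℂ) ^ 2 / Complex.exp (Complex.I * thetaArg k u) := by
  rw [halfNomeExp_eq, thetaArg_neg, mul_neg, Complex.exp_neg, div_eq_mul_inv]

lemma IsSingularModulus.ellipticK_pos {r k : ℝ} (hk : IsSingularModulus r k) : 0 < ellipticK k :=
  _root_.ellipticK_pos hk.pos.le hk.lt_one

lemma IsSingularModulus.ellipticK_compl {r k : ℝ} (hk : IsSingularModulus r k) :
    ellipticK (Real.sqrt (1 - k ^ 2)) = Real.sqrt r * ellipticK k :=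
  (div_eq_iff hk.ellipticK_pos.ne').1 hk.ratio

/-- Since `√r = K'/K`, the modulus is `exp (-π (K' + Im u) / (2K))`. The condition at both `u` and
`-u` thus describes the strip `|Im u| < K'`. -/
lemma norm_halfNomeExp_lt_one_iff {r k : ℝ} (hk : IsSingularModulus r k) (u : ℂ) :
    ‖halfNomeExp r k u‖ < 1 ↔ -ellipticK (Real.sqrt (1 - k ^ 2)) < u.im := by
  have hK := hk.ellipticK_pos
  have hpi := Real.pi_pos
  have e : Complex.I * thetaArg k u = ((Real.pi / (2 * ellipticK k) : ℝ) : ℂ) * (Complex.I * u) := by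
    rw [thetaArg]; push_cast; ring
  have h2 : Real.exp (-Real.pi * Real.sqrt r / 4) ^ 2 = Real.exp (-Real.pi * Real.sqrt r / 2) := by
    rw [← Real.exp_nat_mul]; congr 1; push_cast; ring
  rw [halfNomeExp_eq, norm_mul, norm_pow, Complex.norm_real,
    Real.norm_of_nonneg (quarterNome_pos r).le, quarterNome, h2, Complex.norm_exp, e,
    Complex.re_ofReal_mul, ← Real.exp_add, Real.exp_lt_one_iff, hk.ellipticK_compl]
  have : -Real.pi * Real.sqrt r / 2 + Real.pi / (2 * ellipticK k) * (Complex.I * u).re =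
      Real.pi / (2 * ellipticK k) * -(Real.sqrt r * ellipticK k + u.im) := by
    rw [Complex.I_mul_re]
    field_simp
    ring
  rw [this, mul_neg, neg_lt_zero, mul_pos_iff_of_pos_left (by positivity)]
  constructor <;> intro h <;> linarith

lemma nome_pos (r : ℝ) : 0 < nome r := Real.exp_pos _

lemma nome_lt_one {r : ℝ} (hr : 0 < r) : nome r < 1 := by
  rw [← quarterNome_pow_four]
  exact pow_lt_one₀ (quarterNome_pos r).le (quarterNome_lt_one hr) (by norm_num)

/-- The coefficient `2 π / (K k)` of the Fourier series. -/
noncomputable def fourierConst (k : ℝ) : ℂ := 2 * Real.pi / (ellipticK k * k)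

lemma IsSingularModulus.fourierConst_eq {r k : ℝ} (hr : 0 < r) (hk : IsSingularModulus r k) :
    fourierConst k = 4 / (thetaTwo (quarterNome r) : ℂ) ^ 2 := by
  have hpi : (Real.pi : ℂ) ≠ 0 := by exact_mod_cast Real.pi_ne_zero
  have h2 : (thetaTwo (quarterNome r) : ℂ) ≠ 0 := by
    exact_mod_cast (thetaTwo_pos (quarterNome_pos r) (quarterNome_lt_one hr)).ne'
  rw [fourierConst, ← Complex.ofReal_mul, hk.ellipticK_mul hr]
  push_cast
  field_simp
  norm_num

/-- The Fourier series of `cd`. -/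
lemma jacobiCd_eq_oddLambert {r k : ℝ} (hr : 0 < r) (hk : IsSingularModulus r k) {u : ℂ}
    (hu : ‖halfNomeExp r k u‖ < 1) (hu' : ‖halfNomeExp r k (-u)‖ < 1)
    (h3 : theta3 r (thetaArg k u) ≠ 0) :
    jacobiCd r k u = fourierConst k / 2 *
      (oddLambert (nome r) (halfNomeExp r k u) + oddLambert (nome r) (halfNomeExp r k (-u))) := by
  have h0 := quarterNome_pos r
  have h1 := quarterNome_lt_one hr
  have p2 : (thetaTwo (quarterNome r) : ℂ) ≠ 0 := by exact_mod_cast (thetaTwo_pos h0 h1).ne'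
  have p3 : (thetaThree (quarterNome r) : ℂ) ≠ 0 := by exact_mod_cast (thetaThree_pos h0 h1).ne'
  have hC : 2 * (lambertConst (quarterNome r) : ℂ) =
      thetaTwo (quarterNome r) * thetaThree (quarterNome r) := by
    exact_mod_cast lambertConst_eq h0 h1
  rw [halfNomeExp_eq] at hu
  rw [halfNomeExp_neg] at hu'
  have h := thetaEven_mul_oddLambert h0 h1 (Complex.exp_ne_zero _) hu hu'
  rw [quarterNome_pow_four, ← halfNomeExp_eq, ← halfNomeExp_neg, ← theta3_eq_thetaEven,
    ← theta2_eq_thetaOdd] at h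
  rw [jacobiCd, theta3_zero, theta2_zero, hk.fourierConst_eq hr]
  field_simp
  linear_combination (-4) * h - 2 * theta2 r (thetaArg k u) * hC

/-- The sum of the series of `cd₁` on the strip where it converges. -/
noncomputable def cdOneStrip (r k : ℝ) (u : ℂ) : ℂ :=
  fourierConst k / 2 *
    (Complex.exp (2 * Complex.I * thetaArg k u) * oddLambert (nome r) (halfNomeExp r k u) +
      Complex.exp (-(2 * Complex.I * thetaArg k u)) *
        oddLambert (nome r) (halfNomeExp r k (-u)))

lemma cdOneStrip_neg (r k : ℝ) (u : ℂ) : cdOneStrip r k (-u) = cdOneStrip r k u := by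
  rw [cdOneStrip, cdOneStrip, thetaArg_neg, neg_neg, mul_neg, neg_neg, add_comm]

lemma hasSum_cdOneTerm {r k : ℝ} (hr : 0 < r) {u : ℂ}
    (hu : ‖halfNomeExp r k u‖ < 1) (hu' : ‖halfNomeExp r k (-u)‖ < 1) :
    HasSum (cdOneTerm r k u) (cdOneStrip r k u) := by
  have s1 : HasSum _ (oddLambert (nome r) (halfNomeExp r k u)) :=
    (summable_oddLambert (nome_pos r) (nome_lt_one hr) hu).hasSum
  have s2 : HasSum _ (oddLambert (nome r) (halfNomeExp r k (-u))) :=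
    (summable_oddLambert (nome_pos r) (nome_lt_one hr) hu').hasSum
  have h := ((s1.mul_left (Complex.exp (2 * Complex.I * thetaArg k u))).add
    (s2.mul_left (Complex.exp (-(2 * Complex.I * thetaArg k u))))).mul_left (fourierConst k / 2)
  convert! h using 1
  ext n
  have ecos : Complex.cos ((2 * n + 3) * (Real.pi / (2 * ellipticK k)) * u) =
      (Complex.exp (2 * Complex.I * thetaArg k u) *
          Complex.exp (Complex.I * thetaArg k u) ^ (2 * n + 1) +
        Complex.exp (-(2 * Complex.I * thetaArg k u)) /
          Complex.exp (Complex.I * thetaArg k u) ^ (2 * n + 1)) / 2 := by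
    rw [← Complex.exp_nat_mul, ← Complex.exp_sub, ← Complex.exp_add, Complex.cos, thetaArg]
    congr 3
    · push_cast; ring
    · push_cast; ring
  have eq : ((nome r ^ ((n : ℝ) + 1 / 2) : ℝ) : ℂ) = ((quarterNome r : ℂ) ^ 2) ^ (2 * n + 1) := by
    rw [nome, ← Real.exp_mul, quarterNome, ← Complex.ofReal_pow, ← Complex.ofReal_pow,
      ← Real.exp_nat_mul, ← Real.exp_nat_mul]
    congr 2
    push_cast; ring
  rw [cdOneTerm, ← fourierConst, ecos, eq, halfNomeExp_eq, halfNomeExp_neg, mul_pow, div_pow]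
  have := Complex.exp_ne_zero (Complex.I * thetaArg k u)
  ring

/-! ### Meromorphic continuation of `cd₁`. -/

/-- The meromorphic continuation of `cd₁` to a half-plane. -/
noncomputable def cdOneUpper (r k : ℝ) (u : ℂ) : ℂ :=
  Complex.exp (-(2 * Complex.I * thetaArg k u)) * jacobiCd r k u +
    fourierConst k / 2 * (Complex.exp (2 * Complex.I * thetaArg k u) -
      Complex.exp (-(2 * Complex.I * thetaArg k u))) * oddLambert (nome r) (halfNomeExp r k u)

/-- The Fourier series of `cd` eliminates the Lambert series at `-u`, the only part of `cdOneStrip`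
that is confined to the strip. -/
lemma cdOneUpper_eq_cdOneStrip {r k : ℝ} (hr : 0 < r) (hk : IsSingularModulus r k) {u : ℂ}
    (hu : ‖halfNomeExp r k u‖ < 1) (hu' : ‖halfNomeExp r k (-u)‖ < 1)
    (h3 : theta3 r (thetaArg k u) ≠ 0) : cdOneUpper r k u = cdOneStrip r k u := by
  rw [cdOneUpper, cdOneStrip, jacobiCd_eq_oddLambert hr hk hu hu' h3]
  ring

lemma differentiableOn_oddLambert {q : ℝ} (h0 : 0 < q) (h1 : q < 1) :
    DifferentiableOn ℂ (oddLambert q) (Metric.ball 0 1) := by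
  intro w hw
  obtain ⟨ρ, hρ, hρ1⟩ := exists_between (mem_ball_zero_iff.1 hw)
  have hρ0 : 0 ≤ ρ := (norm_nonneg w).trans hρ.le
  have h : DifferentiableOn ℂ (oddLambert q) (Metric.ball 0 ρ) := by
    refine Complex.differentiableOn_tsum_of_summable_norm
      ((summable_pow_odd hρ0 hρ1).mul_right (1 - q)⁻¹) (fun n => ?_) Metric.isOpen_ball
      fun n v hv => (norm_oddLambert_term_le h0 h1 v n).trans ?_
    · fun_prop
    · have : ‖v‖ ≤ ρ := (mem_ball_zero_iff.1 hv).le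
      have : 0 ≤ (1 - q)⁻¹ := inv_nonneg.2 (by linarith)
      gcongr
  exact ((h w (mem_ball_zero_iff.2 hρ)).differentiableAt
    (Metric.isOpen_ball.mem_nhds (mem_ball_zero_iff.2 hρ))).differentiableWithinAt

lemma differentiable_thetaArg (k : ℝ) : Differentiable ℂ (thetaArg k) := by
  unfold thetaArg; fun_prop

lemma differentiable_halfNomeExp (r k : ℝ) : Differentiable ℂ (halfNomeExp r k) := by
  unfold halfNomeExp; fun_prop

lemma nomeTau_im_pos {r : ℝ} (hr : 0 < r) : 0 < (nomeTau r).im := by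
  simpa [nomeTau] using hr

lemma differentiable_theta3 {r : ℝ} (hr : 0 < r) : Differentiable ℂ (theta3 r) := fun z =>
  (differentiableAt_jacobiTheta₂_fst (z / Real.pi) (nomeTau_im_pos hr)).comp z
    (f := fun z : ℂ => z / Real.pi) (by fun_prop)

lemma differentiable_theta2 {r : ℝ} (hr : 0 < r) : Differentiable ℂ (theta2 r) := fun z =>
  DifferentiableAt.mul (by fun_prop)
    ((differentiableAt_jacobiTheta₂_fst (z / Real.pi + nomeTau r / 2) (nomeTau_im_pos hr)).comp z
      (f := fun z : ℂ => z / Real.pi + nomeTau r / 2) (by fun_prop))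

lemma analyticAt_oddLambert_halfNomeExp {r k : ℝ} (hr : 0 < r) {u : ℂ}
    (hu : ‖halfNomeExp r k u‖ < 1) :
    AnalyticAt ℂ (fun u => oddLambert (nome r) (halfNomeExp r k u)) u := by
  have h := (differentiableOn_oddLambert (nome_pos r) (nome_lt_one hr)).analyticAt
    (Metric.isOpen_ball.mem_nhds (mem_ball_zero_iff.2 hu))
  exact h.comp ((differentiable_halfNomeExp r k).analyticAt u)

lemma analyticAt_exp_two_thetaArg (k : ℝ) (u : ℂ) :
    AnalyticAt ℂ (fun u => Complex.exp (2 * Complex.I * thetaArg k u)) u := by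
  have := differentiable_thetaArg k
  exact Differentiable.analyticAt (by fun_prop) u

lemma analyticAt_exp_neg_two_thetaArg (k : ℝ) (u : ℂ) :
    AnalyticAt ℂ (fun u => Complex.exp (-(2 * Complex.I * thetaArg k u))) u := by
  have := differentiable_thetaArg k
  exact Differentiable.analyticAt (by fun_prop) u

lemma analyticAt_cdOneStrip {r k : ℝ} (hr : 0 < r) {u : ℂ}
    (hu : ‖halfNomeExp r k u‖ < 1) (hu' : ‖halfNomeExp r k (-u)‖ < 1) :
    AnalyticAt ℂ (cdOneStrip r k) u := by
  have h2 : AnalyticAt ℂ (fun u => oddLambert (nome r) (halfNomeExp r k (-u))) u :=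
    (analyticAt_oddLambert_halfNomeExp hr hu').comp (f := fun u : ℂ => -u) (by fun_prop)
  exact analyticAt_const.mul
    (((analyticAt_exp_two_thetaArg k u).mul (analyticAt_oddLambert_halfNomeExp hr hu)).add
      ((analyticAt_exp_neg_two_thetaArg k u).mul h2))

lemma differentiable_theta3_thetaArg {r : ℝ} (hr : 0 < r) (k : ℝ) :
    Differentiable ℂ fun u => theta3 r (thetaArg k u) :=
  (differentiable_theta3 hr).comp (differentiable_thetaArg k)

lemma differentiable_theta2_thetaArg {r : ℝ} (hr : 0 < r) (k : ℝ) :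
    Differentiable ℂ fun u => theta2 r (thetaArg k u) :=
  (differentiable_theta2 hr).comp (differentiable_thetaArg k)

lemma meromorphicAt_jacobiCd {r : ℝ} (hr : 0 < r) (k : ℝ) (u : ℂ) :
    MeromorphicAt (jacobiCd r k) u :=
  (MeromorphicAt.const _ u).mul
    (((differentiable_theta2_thetaArg hr k).analyticAt u).meromorphicAt.div
      ((differentiable_theta3_thetaArg hr k).analyticAt u).meromorphicAt)

lemma analyticAt_jacobiCd {r : ℝ} (hr : 0 < r) {k : ℝ} {u : ℂ}
    (h3 : theta3 r (thetaArg k u) ≠ 0) : AnalyticAt ℂ (jacobiCd r k) u :=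
  analyticAt_const.mul (((differentiable_theta2_thetaArg hr k).analyticAt u).div
    ((differentiable_theta3_thetaArg hr k).analyticAt u) h3)

lemma meromorphicAt_cdOneUpper {r k : ℝ} (hr : 0 < r) {u : ℂ} (hu : ‖halfNomeExp r k u‖ < 1) :
    MeromorphicAt (cdOneUpper r k) u :=
  ((analyticAt_exp_neg_two_thetaArg k u).meromorphicAt.mul (meromorphicAt_jacobiCd hr k u)).add
    ((analyticAt_const.mul ((analyticAt_exp_two_thetaArg k u).sub
      (analyticAt_exp_neg_two_thetaArg k u))).mul
        (analyticAt_oddLambert_halfNomeExp hr hu)).meromorphicAt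

lemma analyticAt_cdOneUpper {r k : ℝ} (hr : 0 < r) {u : ℂ} (hu : ‖halfNomeExp r k u‖ < 1)
    (h3 : theta3 r (thetaArg k u) ≠ 0) : AnalyticAt ℂ (cdOneUpper r k) u :=
  ((analyticAt_exp_neg_two_thetaArg k u).mul (analyticAt_jacobiCd hr h3)).add
    ((analyticAt_const.mul ((analyticAt_exp_two_thetaArg k u).sub
      (analyticAt_exp_neg_two_thetaArg k u))).mul (analyticAt_oddLambert_halfNomeExp hr hu))

lemma eventually_theta3_thetaArg_ne_zero {r : ℝ} (hr : 0 < r) (k : ℝ) (u : ℂ) :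
    ∀ᶠ v in 𝓝[≠] u, theta3 r (thetaArg k v) ≠ 0 := by
  have han : AnalyticOnNhd ℂ (fun u => theta3 r (thetaArg k u)) Set.univ :=
    fun v _ => (differentiable_theta3_thetaArg hr k).analyticAt v
  by_contra h
  rw [not_eventually] at h
  have h0 := han.eqOn_zero_of_preconnected_of_frequently_eq_zero isPreconnected_univ
    (Set.mem_univ u) (h.mono fun v hv => not_not.1 hv) (Set.mem_univ 0)
  have hz : theta3 r (thetaArg k 0) = 0 := h0
  rw [thetaArg, mul_zero, zero_div, theta3_zero, Complex.ofReal_eq_zero] at hz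
  exact (thetaThree_pos (quarterNome_pos r) (quarterNome_lt_one hr)).ne' hz

lemma norm_halfNomeExp_lt_one_of_abs {r k : ℝ} (hk : IsSingularModulus r k) {u : ℂ}
    (hu : |u.im| < ellipticK (Real.sqrt (1 - k ^ 2))) :
    ‖halfNomeExp r k u‖ < 1 ∧ ‖halfNomeExp r k (-u)‖ < 1 := by
  rw [norm_halfNomeExp_lt_one_iff hk, norm_halfNomeExp_lt_one_iff hk, Complex.neg_im]
  have := abs_lt.1 hu
  constructor <;> linarith

open Classical in
/-- A meromorphic function on the plane that continues the sum of the series of `cd₁`. -/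
noncomputable def cdOneGlued (r k : ℝ) (u : ℂ) : ℂ :=
  if |u.im| < ellipticK (Real.sqrt (1 - k ^ 2)) then cdOneStrip r k u
  else if 0 < u.im then cdOneUpper r k u else cdOneUpper r k (-u)

lemma cdOneGlued_eventuallyEq_cdOneStrip {r k : ℝ} {u : ℂ}
    (hu : |u.im| < ellipticK (Real.sqrt (1 - k ^ 2))) :
    cdOneGlued r k =ᶠ[𝓝 u] cdOneStrip r k := by
  have ho : IsOpen {v : ℂ | |v.im| < ellipticK (Real.sqrt (1 - k ^ 2))} :=
    isOpen_lt (Complex.continuous_im.abs) continuous_const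
  filter_upwards [ho.mem_nhds hu] with v hv
  exact if_pos hv

lemma meromorphicAt_cdOneGlued {r k : ℝ} (hr : 0 < r) (hk : IsSingularModulus r k) (u : ℂ) :
    MeromorphicAt (cdOneGlued r k) u := by
  have hK' : 0 < ellipticK (Real.sqrt (1 - k ^ 2)) := by
    rw [hk.ellipticK_compl]
    exact mul_pos (Real.sqrt_pos.2 hr) hk.ellipticK_pos
  by_cases hu : |u.im| < ellipticK (Real.sqrt (1 - k ^ 2))
  · obtain ⟨h1, h2⟩ := norm_halfNomeExp_lt_one_of_abs hk hu
    exact (analyticAt_cdOneStrip hr h1 h2).meromorphicAt.congr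
      ((cdOneGlued_eventuallyEq_cdOneStrip hu).symm.filter_mono nhdsWithin_le_nhds)
  rcases lt_or_ge 0 u.im with him | him
  · have hm : MeromorphicAt (cdOneUpper r k) u :=
      meromorphicAt_cdOneUpper hr ((norm_halfNomeExp_lt_one_iff hk u).2 (by linarith))
    refine hm.congr ?_
    have ho : IsOpen {v : ℂ | 0 < v.im} := isOpen_lt continuous_const Complex.continuous_im
    -- Near the line `Im u = K'` both branches of the definition occur; they agree off the isolated
    -- zeros of `ϑ₃`, which suffices on a punctured neighbourhood.
    filter_upwards [nhdsWithin_le_nhds (ho.mem_nhds him),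
      eventually_theta3_thetaArg_ne_zero hr k u] with v hv h3
    rw [cdOneGlued]
    split_ifs with hs
    · obtain ⟨h1, h2⟩ := norm_halfNomeExp_lt_one_of_abs hk hs
      exact cdOneUpper_eq_cdOneStrip hr hk h1 h2 h3
    · rfl
  -- Below the strip the continuation comes from the upper one by evenness of `cdOneStrip`.
  · have him' : u.im < 0 := by
      rw [abs_of_nonpos him] at hu
      linarith
    have hm : MeromorphicAt (fun v => cdOneUpper r k (-v)) u :=
      (meromorphicAt_cdOneUpper (u := -u) hr
        ((norm_halfNomeExp_lt_one_iff hk (-u)).2 (by rw [Complex.neg_im]; linarith))).comp_analyticAt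
        (f := cdOneUpper r k) (g := fun v : ℂ => -v) (by fun_prop)
    refine hm.congr ?_
    have ho : IsOpen {v : ℂ | v.im < 0} := isOpen_lt Complex.continuous_im continuous_const
    have hneg : Tendsto (fun v : ℂ => -v) (𝓝[≠] u) (𝓝[≠] (-u)) :=
      tendsto_nhdsWithin_iff.2 ⟨(continuous_neg.tendsto u).mono_left nhdsWithin_le_nhds, by
        filter_upwards [self_mem_nhdsWithin] with v hv using fun h => hv (neg_injective h)⟩
    filter_upwards [nhdsWithin_le_nhds (ho.mem_nhds him'),
      hneg.eventually (eventually_theta3_thetaArg_ne_zero hr k (-u))] with v hv h3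
    rw [cdOneGlued, if_neg (not_lt.2 (le_of_lt hv) : ¬ 0 < v.im)]
    split_ifs with hs
    · obtain ⟨h1, h2⟩ := norm_halfNomeExp_lt_one_of_abs hk hs
      rw [cdOneUpper_eq_cdOneStrip hr hk h2 (by rwa [neg_neg]) h3, cdOneStrip_neg]
    · rfl

lemma exists_isCdOne {r k : ℝ} (hr : 0 < r) (hk : IsSingularModulus r k) :
    ∃ F, IsCdOne r k F := by
  have hm : MeromorphicOn (cdOneGlued r k) Set.univ := fun u _ => meromorphicAt_cdOneGlued hr hk u
  refine ⟨toMeromorphicNFOn (cdOneGlued r k) Set.univ, meromorphicNFOn_toMeromorphicNFOn _ _,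
    fun u hu => ?_⟩
  obtain ⟨h1, h2⟩ := norm_halfNomeExp_lt_one_of_abs hk hu
  have hev := cdOneGlued_eventuallyEq_cdOneStrip (r := r) hu
  have han : AnalyticAt ℂ (cdOneGlued r k) u := (analyticAt_cdOneStrip hr h1 h2).congr hev.symm
  -- Passing to the normal form changes no value in the strip, because the glued function is
  -- analytic there.
  rw [toMeromorphicNFOn_eq_toMeromorphicNFAt hm (Set.mem_univ u),
    toMeromorphicNFAt_eq_self.2 han.meromorphicNFAt, hev.eq_of_nhds]
  exact hasSum_cdOneTerm hr h1 h2

/-- Identity theorem on the half-plane `Im u > -K'`: the difference has order `⊤` at `0`, inside the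
strip, hence everywhere by connectedness. -/
lemma IsCdOne.eq_cdOneUpper {r k : ℝ} (hr : 0 < r) (hk : IsSingularModulus r k) {F : ℂ → ℂ}
    (hF : IsCdOne r k F) {u : ℂ} (hu : ‖halfNomeExp r k u‖ < 1)
    (h3 : theta3 r (thetaArg k u) ≠ 0) : F u = cdOneUpper r k u := by
  set K' := ellipticK (Real.sqrt (1 - k ^ 2)) with hK'def
  have hK' : 0 < K' := by
    rw [hK'def, hk.ellipticK_compl]
    exact mul_pos (Real.sqrt_pos.2 hr) hk.ellipticK_pos
  let U : Set ℂ := {v | -K' < v.im}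
  have hU : IsPreconnected U := (convex_halfSpace_im_gt (-K')).isPreconnected
  have hmU : MeromorphicOn (F - cdOneUpper r k) U := fun v hv =>
    (hF.meromorphic (Set.mem_univ v)).meromorphicAt.sub
      (meromorphicAt_cdOneUpper hr ((norm_halfNomeExp_lt_one_iff hk v).2 hv))
  have htop : meromorphicOrderAt (F - cdOneUpper r k) 0 = ⊤ := by
    rw [meromorphicOrderAt_eq_top_iff]
    have ho : IsOpen {v : ℂ | |v.im| < K'} :=
      isOpen_lt (Complex.continuous_im.abs) continuous_const
    filter_upwards [nhdsWithin_le_nhds (ho.mem_nhds (by simpa using hK' : (0 : ℂ) ∈ _)),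
      eventually_theta3_thetaArg_ne_zero hr k 0] with v hv hv3
    obtain ⟨h1, h2⟩ := norm_halfNomeExp_lt_one_of_abs hk hv
    rw [Pi.sub_apply, cdOneUpper_eq_cdOneStrip hr hk h1 h2 hv3,
      (hF.hasSum v hv).unique (hasSum_cdOneTerm hr h1 h2), sub_self]
  have huU : u ∈ U := (norm_halfNomeExp_lt_one_iff hk u).1 hu
  have htop' : meromorphicOrderAt (F - cdOneUpper r k) u = ⊤ := by
    by_contra hne
    exact hmU.meromorphicOrderAt_ne_top_of_isPreconnected hU huU
      (by simpa [U] using hK' : (0 : ℂ) ∈ U) hne htop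
  rw [meromorphicOrderAt_eq_top_iff] at htop'
  have hev : F =ᶠ[𝓝[≠] u] cdOneUpper r k := by
    filter_upwards [htop'] with v hv using sub_eq_zero.1 hv
  -- Both functions are in normal form at `u`, so equality on a punctured neighbourhood extends to
  -- `u` itself.
  exact (((hF.meromorphic (Set.mem_univ u)).eventuallyEq_nhdsNE_iff_eventuallyEq_nhds
    (analyticAt_cdOneUpper hr hu h3).meromorphicNFAt).1 hev).eq_of_nhds

/-! ### The final identity. -/

lemma I_mul_pow_odd (w : ℂ) (n : ℕ) :
    (Complex.I * w) ^ (2 * n + 1) = Complex.I * ((-1) ^ n * w ^ (2 * n + 1)) := by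
  rw [mul_pow, pow_succ Complex.I, pow_mul, Complex.I_sq]; ring

theorem theorem9 (r k : ℝ) (hr : 0 < r) (hk : IsSingularModulus r k) :
    IsCdOne r k (cdOne r k) ∧
    ∀ u : ℂ, ‖halfNomeExp r k u‖ < 1 →
      Complex.sin (Real.pi * u / ellipticK k) ≠ 0 →
      theta3 r (thetaArg k u) ≠ 0 →
      Summable (fun n : ℕ =>
        (Complex.I * halfNomeExp r k u) ^ (2 * n + 1) / (1 - (nome r : ℂ) ^ (2 * n + 1))) ∧
      (2 * Real.pi / (ellipticK k * k) : ℂ) *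
          ∑' n : ℕ, (Complex.I * halfNomeExp r k u) ^ (2 * n + 1) /
            (1 - (nome r : ℂ) ^ (2 * n + 1)) =
        -jacobiCd r k u * Complex.cot (Real.pi * u / ellipticK k) +
          cdOne r k u * (1 / Complex.sin (Real.pi * u / ellipticK k)) +
          Complex.I * jacobiCd r k u := by
  have hcd : IsCdOne r k (cdOne r k) := Classical.epsilon_spec (exists_isCdOne hr hk)
  refine ⟨hcd, fun u hu hsin h3 => ?_⟩
  have hs := (summable_oddLambert (nome_pos r) (nome_lt_one hr) hu).hasSum.mul_left Complex.I
  simp only [← mul_div_assoc, ← I_mul_pow_odd] at hs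
  refine ⟨hs.summable, ?_⟩
  have harg : 2 * thetaArg k u = Real.pi * u / ellipticK k := by
    have hK : (ellipticK k : ℂ) ≠ 0 := by exact_mod_cast hk.ellipticK_pos.ne'
    rw [thetaArg]; field_simp
  rw [hs.tsum_eq, ← oddLambert, ← fourierConst, hcd.eq_cdOneUpper hr hk hu h3, cdOneUpper,
    Complex.cot]
  rw [← harg] at hsin ⊢
  -- With both exponentials in terms of `cos 2z` and `sin 2z`, the coefficient of the Lambert series
  -- is `(c/2) · 2i sin 2z`, and division by `sin 2z` leaves an algebraic identity.
  have e1 : Complex.exp (2 * Complex.I * thetaArg k u) =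
      Complex.cos (2 * thetaArg k u) + Complex.sin (2 * thetaArg k u) * Complex.I := by
    rw [← Complex.exp_mul_I]; ring_nf
  have e2 : Complex.exp (-(2 * Complex.I * thetaArg k u)) =
      Complex.cos (2 * thetaArg k u) - Complex.sin (2 * thetaArg k u) * Complex.I := by
    have := Complex.exp_mul_I (-(2 * thetaArg k u))
    rw [Complex.sin_neg, Complex.cos_neg, neg_mul (Complex.sin _), ← sub_eq_add_neg] at this
    rw [← this]; ring_nf
  rw [e1, e2]
  field_simp
  ring
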